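/- Let $G$ be a locally compact (Hausdorff) group with a fixed left Haar measure $\lambda$, and let $1<p<\infty$. For measurable $f,g:G\to\mathbb{C}$ put $(g*f)(x)=\int_G g(y)f(y^{-1}x)\,d\lambda(y)$; we say that $g*f$ exists if for almost every $x\in G$ the function $y\mapsto g(y)f(y^{-1}x)$ is $\lambda$-integrable. Let $L^T_p(G)$ be the set of all $f\in L^p(G)$ such that $g*f$ exists for all $g\in L^p(G)$ and $$\|f\|_p^T=\sup\{\|g*f\|_p:\ g\in L^p(G),\ \|g\|_p\le 1\}<\infty ,$$ and put $|||f|||_p^T=\|f\|_p+\|f\|_p^T$ for $f\in L^T_p(G)$. Consider the following assertions. (i) $L^T_p(G)$ is a Banach algebra under $\|\cdot\|_p^T$ and the convolution product. (ii) There exists a constant $K>0$ such that $|||f|||_p^T\le K\|f\|_p^T$ for each $f\in L^T_p(G)$. (iii) The norms $\|\cdot\|_p^T$ and $|||\cdot|||_p^T$ are equivalent on $L^T_p(G)$. (iv) There exists a constant $K>0$ such that $\|f\|_p\le K\|f\|_p^T$ for each $f\in L^T_p(G)$. (v) $G$ is discrete. Then (v)$\Rightarrow$(iv), (iv)$\Rightarrow$(iii)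 and (iii)$\Rightarrow$(ii). If $G$ is unimodular and $1<p\le 2$, then all five assertions are equivalent. -/

import Mathlib

open MeasureTheory
open scoped ENNReal

noncomputable section

namespace LpT

section Convolution

variable {G : Type*} [Group G] [MeasurableSpace G]

/-- The convolution `(f * g)(x) = ∫ f(y) g(y⁻¹ x) dμ(y)`. -/
def conv (μ : Measure G) (f g : G → ℂ) (x : G) : ℂ :=
  ∫ y, f y * g (y⁻¹ * x) ∂μ

/-- The convolution `f * g` exists: for almost every `x`, the function `y ↦ f(y) g(y⁻¹ x)` is
integrable. -/
def ConvExists (μ : Measure G) (f g : G → ℂ) : Prop :=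
  ∀ᵐ x ∂μ, Integrable (fun y => f y * g (y⁻¹ * x)) μ

/-- The supremum of `‖g * f‖_p` over `g` in the closed unit ball of `L^p`, in `[0, ∞]`. -/
def enormT (μ : Measure G) (p : ℝ≥0∞) (f : Lp ℂ p μ) : ℝ≥0∞ :=
  ⨆ (g : Lp ℂ p μ) (_ : ‖g‖ ≤ 1), eLpNorm (conv μ g f) p μ

/-- The set of all `f ∈ L^p` such that `g * f` exists for all `g ∈ L^p` and
`sup {‖g * f‖_p : g ∈ L^p, ‖g‖_p ≤ 1}` is finite. -/
def carrier (μ : Measure G) (p : ℝ≥0∞) : Set (Lp ℂ p μ) :=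
  {f | (∀ g : Lp ℂ p μ, ConvExists μ g f) ∧ enormT μ p f < ∞}

/-- The norm `‖f‖_p^T`, as a real number (used for `f ∈ carrier μ p`, where the supremum is
finite). -/
def normT (μ : Measure G) (p : ℝ≥0∞) (f : Lp ℂ p μ) : ℝ :=
  (enormT μ p f).toReal

/-- The norm `‖f‖_p + ‖f‖_p^T`. -/
def sumNormT (μ : Measure G) (p : ℝ≥0∞) (f : Lp ℂ p μ) : ℝ :=
  ‖f‖ + normT μ p f

end Convolution

/-- Two real functions (norms) are equivalent on a set. -/
def EquivOn {V : Type*} (S : Set V) (N₁ N₂ : V → ℝ) : Prop :=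
  ∃ c > 0, ∃ C > 0, ∀ f ∈ S, c * N₁ f ≤ N₂ f ∧ N₂ f ≤ C * N₁ f

/-- The complex vector space `A` is a (not necessarily unital) Banach algebra under the
multiplication `mul` and the norm `N`. -/
structure IsBanachAlgebra {A : Type*} [AddCommGroup A] [Module ℂ A]
    (mul : A → A → A) (N : A → ℝ) : Prop where
  norm_eq_zero : ∀ a, N a = 0 ↔ a = 0
  norm_add_le : ∀ a b, N (a + b) ≤ N a + N b
  norm_smul : ∀ (c : ℂ) a, N (c • a) = ‖c‖ * N a
  mul_assoc : ∀ a b c, mul (mul a b) c = mul a (mul b c)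
  add_mul : ∀ a b c, mul (a + b) c = mul a c + mul b c
  mul_add : ∀ a b c, mul a (b + c) = mul a b + mul a c
  smul_mul : ∀ (z : ℂ) a b, mul (z • a) b = z • mul a b
  mul_smul : ∀ (z : ℂ) a b, mul a (z • b) = z • mul a b
  norm_mul_le : ∀ a b, N (mul a b) ≤ N a * N b
  complete : ∀ u : ℕ → A,
    (∀ ε > 0, ∃ n₀, ∀ m ≥ n₀, ∀ n ≥ n₀, N (u m - u n) < ε) →
      ∃ a, ∀ ε > 0, ∃ n₀, ∀ n ≥ n₀, N (u n - a) < ε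

/-- `L_p^T` is a Banach algebra under `‖·‖_p^T` and convolution: it is a linear subspace of `L^p`,
it is closed under convolution, and it is a Banach algebra for these operations. -/
def IsConvBanachAlgebra {G : Type*} [Group G] [MeasurableSpace G]
    (μ : Measure G) (p : ℝ≥0∞) : Prop :=
  ∃ S : Submodule ℂ (Lp ℂ p μ), (S : Set (Lp ℂ p μ)) = carrier μ p ∧
    ∃ mul : S → S → S,
      (∀ f g : S, ((mul f g : Lp ℂ p μ) : G → ℂ) =ᵐ[μ]
        conv μ (f : Lp ℂ p μ) (g : Lp ℂ p μ)) ∧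
      IsBanachAlgebra mul (fun f : S => normT μ p f)

end LpT

end

namespace LpT

open Filter Topology Set
open scoped Pointwise

/-! The formal implications cost nothing: (iv), (iii) and (ii) differ by adding `‖f‖_p^T` to both
sides. For (v) ⇒ (iv), convolving with the indicator of `{1}` multiplies `f` by the mass of a point
(`norm_le_mul_normT_of_discrete`).

In the unimodular case Young's inequality gives `‖f‖_p^T ≤ ‖f‖_1` for `f ∈ C_c(G)`
(`enormT_toLp_le`). If `G` is not discrete, points are null, so functions in `C_c(G)` of `L^p` norm
one can have arbitrarily small `L^1` norm, which contradicts (iv).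

For (i) ⇒ (v) only completeness matters. On a nondiscrete group take nonnegative `φ n` in `C_c(G)`
with `‖φ n‖_p = 2^n` and `‖φ n‖_1 ≤ 2^(-n)`. Their partial sums are Cauchy in `L^1`, hence in
`‖·‖_p^T`. A limit `a ∈ L^p` would satisfy `‖φ n‖_p ≤ ‖a‖_p` for every `n`
(`eLpNorm_le_of_normT_tendsto`), which is absurd.

For (v) ⇒ (i), the only place where `p ≤ 2` enters, a discrete group has `L^p ⊆ L^2`, so by
Cauchy–Schwarz all convolutions exist at every point and depend continuously on both factors.
Associativity follows by approximating with finitely supported functions (`conv_assoc_of_discrete`),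
and completeness from (iv) and the lower semicontinuity of `‖·‖_p^T`.

Haar measure need not be σ-finite, so Tonelli is avoided: integrals are interchanged only for
continuous functions of compact support, and the bounds are extended by density and Fatou. -/

/-- A regular Haar measure that is also right invariant is invariant under inversion. -/
theorem isInvInvariant_of_isMulRightInvariant {G : Type*} [Group G] [TopologicalSpace G]
    [IsTopologicalGroup G] [LocallyCompactSpace G] [MeasurableSpace G] [BorelSpace G]
    (μ : Measure G) [μ.IsHaarMeasure] [μ.Regular] [μ.IsMulRightInvariant] :
    μ.IsInvInvariant := by
  constructor
  let c : ℝ≥0∞ := Measure.haarScalarFactor μ.inv μ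
  -- Right invariance of `μ` makes `μ.inv` left invariant, so uniqueness of Haar measure applies.
  -- Inverting twice then forces `c ^ 2 = 1`.
  have hc : μ.inv = c • μ := Measure.isMulLeftInvariant_eq_smul_of_regular μ.inv μ
  have h1 : Measure.map Inv.inv (Measure.map Inv.inv μ) = c ^ 2 • μ := by
    rw [← Measure.inv_def μ, hc, Measure.map_smul, ← Measure.inv_def μ, hc, smul_smul, pow_two]
  have μeq : μ = c ^ 2 • μ := by
    rw [Measure.map_map continuous_inv.measurable continuous_inv.measurable] at h1
    rwa [show ((fun a : G => a⁻¹) ∘ fun a => a⁻¹) = id from inv_involutive.comp_self,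
      Measure.map_id] at h1
  have K : TopologicalSpace.PositiveCompacts G := Classical.arbitrary _
  have h2 : c ^ 2 * μ K = 1 ^ 2 * μ K := by
    conv_rhs => rw [μeq]
    simp
  have h3 : c ^ 2 = 1 ^ 2 :=
    (ENNReal.mul_left_inj (Measure.measure_pos_of_nonempty_interior _ K.interior_nonempty).ne'
          K.isCompact.measure_lt_top.ne).1 h2
  have h4 : c = 1 := (ENNReal.pow_right_strictMono two_ne_zero).injective h3
  rw [hc, h4, one_smul]

/-! ### Formal properties of convolution and the operator bound -/

section General

variable {G : Type*} [Group G] [MeasurableSpace G] {μ : Measure G} {p : ℝ≥0∞}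

theorem conv_congr_left {f f' : G → ℂ} (h : f =ᵐ[μ] f') (g : G → ℂ) :
    conv μ f g = conv μ f' g := by
  funext x
  refine integral_congr_ae ?_
  filter_upwards [h] with y hy
  rw [hy]

theorem conv_const_smul_left (c : ℂ) (f g : G → ℂ) : conv μ (c • f) g = c • conv μ f g := by
  funext x
  simp only [conv, Pi.smul_apply, smul_eq_mul, mul_assoc]
  exact integral_const_mul c _

theorem conv_const_smul_right (c : ℂ) (f g : G → ℂ) : conv μ f (c • g) = c • conv μ f g := by
  funext x
  simp only [conv, Pi.smul_apply, smul_eq_mul, mul_left_comm _ c]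
  exact integral_const_mul c _

/-- Substitute `y ↦ x * y`. Reflection thus swaps the two factors, which turns one form of Young's
inequality into the other. -/
theorem conv_eq_conv_inv [MeasurableMul G] [μ.IsMulLeftInvariant] (f g : G → ℂ) (x : G) :
    conv μ f g x = conv μ (fun y => g y⁻¹) (fun y => f y⁻¹) x⁻¹ := by
  simp only [conv]
  rw [← integral_mul_left_eq_self _ x]
  refine integral_congr_ae (Eventually.of_forall fun y => ?_)
  simp [mul_comm]

/-- The operator norm bound for convolution with a fixed function. -/
theorem eLpNorm_conv_le_enormT [Fact (1 ≤ p)] (g f : Lp ℂ p μ) :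
    eLpNorm (conv μ g f) p μ ≤ ENNReal.ofReal ‖g‖ * enormT μ p f := by
  rcases eq_or_ne ‖g‖ 0 with h0 | h0
  · rw [norm_eq_zero] at h0
    subst h0
    have : conv μ ((0 : Lp ℂ p μ) : G → ℂ) f = 0 := by
      rw [conv_congr_left (Lp.coeFn_zero ℂ p μ)]
      funext x
      simp [conv]
    rw [this]
    simp
  have hpos : 0 < ‖g‖ := lt_of_le_of_ne (norm_nonneg _) h0.symm
  set c : ℂ := ((‖g‖ : ℝ) : ℂ) with hc
  have hc0 : c ≠ 0 := by simpa [hc] using h0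
  have hcn : ‖c‖ = ‖g‖ := by simp [hc]
  have hle : ‖c⁻¹ • g‖ ≤ 1 := by
    rw [norm_smul, norm_inv, hcn, inv_mul_cancel₀ h0]
  have h1 : eLpNorm (conv μ ((c⁻¹ • g : Lp ℂ p μ) : G → ℂ) f) p μ ≤ enormT μ p f :=
    le_iSup₂ (f := fun (g : Lp ℂ p μ) (_ : ‖g‖ ≤ 1) => eLpNorm (conv μ g f) p μ) (c⁻¹ • g) hle
  have h2 : conv μ (g : G → ℂ) f = c • conv μ ((c⁻¹ • g : Lp ℂ p μ) : G → ℂ) f := by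
    rw [conv_congr_left (Lp.coeFn_smul c⁻¹ g), conv_const_smul_left, smul_smul,
      mul_inv_cancel₀ hc0, one_smul]
  rw [h2, eLpNorm_const_smul]
  gcongr
  rw [← ofReal_norm, hcn]

theorem eLpNorm_conv_le_mul_enormT [Fact (1 ≤ p)] {h : G → ℂ} (hh : MemLp h p μ) (f : Lp ℂ p μ) :
    eLpNorm (conv μ h f) p μ ≤ eLpNorm h p μ * enormT μ p f := by
  have h1 := eLpNorm_conv_le_enormT (hh.toLp h) f
  rwa [conv_congr_left hh.coeFn_toLp, ofReal_norm, Lp.enorm_toLp] at h1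

theorem enormT_eq_ofReal_normT {f : Lp ℂ p μ} (hf : f ∈ carrier μ p) :
    enormT μ p f = ENNReal.ofReal (normT μ p f) :=
  (ENNReal.ofReal_toReal hf.2.ne).symm

theorem normT_nonneg (f : Lp ℂ p μ) : 0 ≤ normT μ p f := ENNReal.toReal_nonneg

theorem eLpNorm_conv_le_normT [Fact (1 ≤ p)] (g : Lp ℂ p μ) {f : Lp ℂ p μ}
    (hf : f ∈ carrier μ p) :
    eLpNorm (conv μ g f) p μ ≤ ENNReal.ofReal (‖g‖ * normT μ p f) := by
  rw [ENNReal.ofReal_mul (norm_nonneg _), ← enormT_eq_ofReal_normT hf]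
  exact eLpNorm_conv_le_enormT g f

end General

/-! ### Hölder bounds for convolution under inversion invariance -/

section Unimodular

variable {G : Type*} [Group G] [TopologicalSpace G] [IsTopologicalGroup G]
  [MeasurableSpace G] [BorelSpace G] {μ : Measure G} [μ.IsMulLeftInvariant] [μ.IsInvInvariant]

-- The map is left translation by `x⁻¹` followed by inversion. Unimodularity enters most estimates
-- in this form.
variable (μ) in
theorem measurePreserving_inv_mul (x : G) : MeasurePreserving (fun y : G => y⁻¹ * x) μ μ := by
  have h := (Measure.measurePreserving_inv μ).comp (measurePreserving_mul_left μ x⁻¹)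
  convert h using 2 with y
  simp

theorem conv_congr_right (f : G → ℂ) {g g' : G → ℂ} (h : g =ᵐ[μ] g') :
    conv μ f g = conv μ f g' := by
  funext x
  refine integral_congr_ae ?_
  filter_upwards [(measurePreserving_inv_mul μ x).quasiMeasurePreserving.ae_eq_comp h] with y hy
  simp only [Function.comp_apply] at hy
  rw [hy]

/-- Hölder's inequality: the reflected translate of `g` is again in `L^b`. Used for conjugate
exponents, and with `a = b = 2` on discrete groups. -/
theorem integrable_conv {a b : ℝ≥0∞} [ENNReal.HolderTriple a b 1] {f g : G → ℂ}
    (hf : MemLp f a μ) (hg : MemLp g b μ) (x : G) :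
    Integrable (fun y => f y * g (y⁻¹ * x)) μ := by
  rw [← memLp_one_iff_integrable]
  exact MemLp.mul' (hg.comp_measurePreserving (measurePreserving_inv_mul μ x)) hf

theorem enorm_conv_le {a b : ℝ≥0∞} [ENNReal.HolderTriple a b 1] {f g : G → ℂ}
    (hf : AEStronglyMeasurable f μ) (hg : AEStronglyMeasurable g μ) (x : G) :
    ‖conv μ f g x‖ₑ ≤ eLpNorm f a μ * eLpNorm g b μ := by
  have hmp := measurePreserving_inv_mul μ x
  calc ‖conv μ f g x‖ₑ ≤ ∫⁻ y, ‖f y * g (y⁻¹ * x)‖ₑ ∂μ := enorm_integral_le_lintegral_enorm _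
    _ = eLpNorm (fun y => f y * g (y⁻¹ * x)) 1 μ := eLpNorm_one_eq_lintegral_enorm.symm
    _ ≤ eLpNorm f a μ * eLpNorm (g ∘ fun y => y⁻¹ * x) b μ := by
        have h := eLpNorm_le_eLpNorm_mul_eLpNorm_of_nnnorm (p := a) (q := b) (r := 1) hf
          (hg.comp_measurePreserving hmp) (fun z w : ℂ => z * w) 1
          (Eventually.of_forall fun y => by rw [one_mul, nnnorm_mul])
        rwa [ENNReal.coe_one, one_mul] at h
    _ = eLpNorm f a μ * eLpNorm g b μ := by rw [eLpNorm_comp_measurePreserving hg hmp]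

theorem conv_sub_left {a b : ℝ≥0∞} [ENNReal.HolderTriple a b 1] {f f' g : G → ℂ}
    (hf : MemLp f a μ) (hf' : MemLp f' a μ) (hg : MemLp g b μ) :
    conv μ (f - f') g = conv μ f g - conv μ f' g := by
  funext x
  simp only [conv, Pi.sub_apply, sub_mul]
  exact integral_sub (integrable_conv hf hg x) (integrable_conv hf' hg x)

theorem conv_sub_right {a b : ℝ≥0∞} [ENNReal.HolderTriple a b 1] {f g g' : G → ℂ}
    (hf : MemLp f a μ) (hg : MemLp g b μ) (hg' : MemLp g' b μ) :
    conv μ f (g - g') = conv μ f g - conv μ f g' := by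
  funext x
  simp only [conv, Pi.sub_apply, mul_sub]
  exact integral_sub (integrable_conv hf hg x) (integrable_conv hf hg' x)

theorem conv_add_left {a b : ℝ≥0∞} [ENNReal.HolderTriple a b 1] {f f' g : G → ℂ}
    (hf : MemLp f a μ) (hf' : MemLp f' a μ) (hg : MemLp g b μ) :
    conv μ (f + f') g = conv μ f g + conv μ f' g := by
  funext x
  simp only [conv, Pi.add_apply, add_mul]
  exact integral_add (integrable_conv hf hg x) (integrable_conv hf' hg x)

theorem conv_add_right {a b : ℝ≥0∞} [ENNReal.HolderTriple a b 1] {f g g' : G → ℂ}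
    (hf : MemLp f a μ) (hg : MemLp g b μ) (hg' : MemLp g' b μ) :
    conv μ f (g + g') = conv μ f g + conv μ f g' := by
  funext x
  simp only [conv, Pi.add_apply, mul_add]
  exact integral_add (integrable_conv hf hg x) (integrable_conv hf hg' x)

end Unimodular

/-! ### Continuity of convolutions -/

section Continuity

variable {G : Type*} [Group G] [TopologicalSpace G] [IsTopologicalGroup G]
  [MeasurableSpace G] [BorelSpace G] {μ : Measure G} [IsFiniteMeasureOnCompacts μ]

theorem continuous_integral_mul_inv_mul {𝕜 : Type*} [RCLike 𝕜] {u v : G → 𝕜} (hu : Continuous u)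
    (hus : HasCompactSupport u) (hv : Continuous v) :
    Continuous fun x => ∫ y, u y * v (y⁻¹ * x) ∂μ := by
  rw [← continuousOn_univ]
  refine continuousOn_integral_of_compact_support (f := fun x y => u y * v (y⁻¹ * x)) hus ?_ ?_
  · exact Continuous.continuousOn (by fun_prop)
  · intro x y _ hy
    simp [image_eq_zero_of_notMem_tsupport hy]

theorem continuous_conv {f g : G → ℂ} (hf : Continuous f) (hfs : HasCompactSupport f)
    (hg : Continuous g) : Continuous (conv μ f g) :=
  continuous_integral_mul_inv_mul hf hfs hg

end Continuity

/-! ### Young's inequality for functions of compact support -/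

section CompactSupport

variable {G : Type*} [Group G] [TopologicalSpace G] [IsTopologicalGroup G]
  [MeasurableSpace G] [BorelSpace G] {μ : Measure G} [μ.IsMulLeftInvariant]
  [IsFiniteMeasureOnCompacts μ] {p : ℝ≥0∞}

/-- Tonelli followed by left translation. Without σ-finiteness the interchange is made for Bochner
integrals of a continuous function supported in `closure (K * L) ×ˢ K`, with `K` and `L` the
supports. -/
theorem lintegral_lintegral_mul_inv_mul {u v : G → ℝ} (hu : Continuous u)
    (hus : HasCompactSupport u) (hu0 : 0 ≤ u) (hv : Continuous v) (hvs : HasCompactSupport v)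
    (hv0 : 0 ≤ v) :
    ∫⁻ x, ∫⁻ y, ENNReal.ofReal (u y * v (y⁻¹ * x)) ∂μ ∂μ
      = (∫⁻ y, ENNReal.ofReal (u y) ∂μ) * ∫⁻ y, ENNReal.ofReal (v y) ∂μ := by
  let K := tsupport u
  let L := tsupport v
  have hKL : IsCompact (closure (K * L)) := (hus.isCompact.mul hvs.isCompact).closure
  have hz : ∀ x y, x ∉ closure (K * L) → u y * v (y⁻¹ * x) = 0 := by
    intro x y hx
    by_contra hne
    have h1 : y ∈ K := subset_tsupport _ (left_ne_zero_of_mul hne)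
    have h2 : y⁻¹ * x ∈ L := subset_tsupport _ (right_ne_zero_of_mul hne)
    exact hx (subset_closure ⟨y, h1, y⁻¹ * x, h2, by simp⟩)
  have hint : ∀ x, Integrable (fun y => u y * v (y⁻¹ * x)) μ := fun x =>
    Continuous.integrable_of_hasCompactSupport (by fun_prop) hus.mul_right
  have hw : Continuous fun x => ∫ y, u y * v (y⁻¹ * x) ∂μ :=
    continuous_integral_mul_inv_mul hu hus hv
  have hws : HasCompactSupport fun x => ∫ y, u y * v (y⁻¹ * x) ∂μ :=
    HasCompactSupport.intro' hKL isClosed_closure fun x hx => by simp [hz x _ hx]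
  have hnn : ∀ x y, 0 ≤ u y * v (y⁻¹ * x) := fun x y => mul_nonneg (hu0 _) (hv0 _)
  calc ∫⁻ x, ∫⁻ y, ENNReal.ofReal (u y * v (y⁻¹ * x)) ∂μ ∂μ
      = ∫⁻ x, ENNReal.ofReal (∫ y, u y * v (y⁻¹ * x) ∂μ) ∂μ := by
        refine lintegral_congr fun x => ?_
        rw [ofReal_integral_eq_lintegral_ofReal (hint x) (Eventually.of_forall (hnn x))]
    _ = ENNReal.ofReal (∫ x, ∫ y, u y * v (y⁻¹ * x) ∂μ ∂μ) := by
        rw [ofReal_integral_eq_lintegral_ofReal (hw.integrable_of_hasCompactSupport hws)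
          (Eventually.of_forall fun x => integral_nonneg (hnn x))]
    _ = ENNReal.ofReal (∫ y, ∫ x, u y * v (y⁻¹ * x) ∂μ ∂μ) := by
        rw [integral_integral_swap_of_hasCompactSupport]
        · exact (hu.comp continuous_snd).mul
            (hv.comp (continuous_snd.inv.mul continuous_fst))
        · refine HasCompactSupport.intro' (hKL.prod hus.isCompact)
            (isClosed_closure.prod (isClosed_tsupport u)) ?_
          rintro ⟨x, y⟩ hxy
          by_cases hx : x ∈ closure (K * L)
          · have hy : y ∉ tsupport u := fun hy => hxy ⟨hx, hy⟩
            simp [Function.uncurry, image_eq_zero_of_notMem_tsupport hy]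
          · exact hz x y hx
    _ = ENNReal.ofReal ((∫ y, u y ∂μ) * ∫ x, v x ∂μ) := by
        simp_rw [integral_const_mul, integral_mul_left_eq_self v, integral_mul_const]
    _ = _ := by
        rw [ENNReal.ofReal_mul (integral_nonneg hu0),
          ofReal_integral_eq_lintegral_ofReal (hu.integrable_of_hasCompactSupport hus)
            (Eventually.of_forall hu0),
          ofReal_integral_eq_lintegral_ofReal (hv.integrable_of_hasCompactSupport hvs)
            (Eventually.of_forall hv0)]

/-- Young's inequality `‖f * g‖_p ≤ ‖f‖_p ‖g‖_1` for continuous functions of compact support. -/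
theorem eLpNorm_conv_le_of_hasCompactSupport [μ.IsInvInvariant] (hp : 1 < p) (hp_top : p ≠ ∞)
    {f g : G → ℂ}
    (hf : Continuous f) (hfs : HasCompactSupport f) (hg : Continuous g)
    (hgs : HasCompactSupport g) :
    eLpNorm (conv μ f g) p μ ≤ eLpNorm f p μ * eLpNorm g 1 μ := by
  have hp0 : p ≠ 0 := (zero_lt_one.trans hp).ne'
  set r := p.toReal with hr
  have hr1 : 1 < r := by
    rw [hr, ← ENNReal.toReal_one]
    exact (ENNReal.toReal_lt_toReal ENNReal.one_ne_top hp_top).2 hp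
  have hr0 : 0 < r := zero_lt_one.trans hr1
  set q := Real.conjExponent r with hq
  have hrq : r.HolderConjugate q := Real.HolderConjugate.conjExponent hr1
  have hq0 : 0 < q := hrq.symm.pos
  set A := ∫⁻ y, ‖g y‖ₑ ∂μ with hA
  -- Hölder for the splitting `|f| |g| = (|f| |g|^(1/r)) · |g|^(1/q)`; the second factor integrates
  -- to `A` because `y ↦ y⁻¹ * x` preserves `μ`.
  have hpt : ∀ x, ‖conv μ f g x‖ₑ ^ r
      ≤ (∫⁻ y, ENNReal.ofReal (‖f y‖ ^ r * ‖g (y⁻¹ * x)‖) ∂μ) * A ^ (r / q) := by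
    intro x
    have hgx : Measurable fun y => ‖g (y⁻¹ * x)‖ₑ :=
      (Continuous.measurable (by fun_prop : Continuous fun y => g (y⁻¹ * x))).enorm
    have hfm : Measurable fun y => ‖f y‖ₑ := hf.measurable.enorm
    have h1 : ‖conv μ f g x‖ₑ ≤ ∫⁻ y, ‖f y‖ₑ * ‖g (y⁻¹ * x)‖ₑ ∂μ := by
      refine (enorm_integral_le_lintegral_enorm _).trans_eq ?_
      simp_rw [enorm_mul]
    have h2 : ∫⁻ y, ‖f y‖ₑ * ‖g (y⁻¹ * x)‖ₑ ∂μ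
        ≤ (∫⁻ y, (‖f y‖ₑ * ‖g (y⁻¹ * x)‖ₑ ^ (1 / r)) ^ r ∂μ) ^ (1 / r) *
          (∫⁻ y, (‖g (y⁻¹ * x)‖ₑ ^ (1 / q)) ^ q ∂μ) ^ (1 / q) := by
      refine le_trans (le_of_eq ?_) (ENNReal.lintegral_mul_le_Lp_mul_Lq μ hrq
        (hfm.mul (hgx.pow_const _)).aemeasurable (hgx.pow_const _).aemeasurable)
      refine lintegral_congr fun y => ?_
      simp only [Pi.mul_apply]
      rw [mul_assoc, ← ENNReal.rpow_add_of_nonneg _ _ (by positivity) (by positivity)]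
      have : 1 / r + 1 / q = 1 := by simpa using hrq.inv_add_inv_eq_one
      rw [this, ENNReal.rpow_one]
    have h3 : ∀ y, (‖f y‖ₑ * ‖g (y⁻¹ * x)‖ₑ ^ (1 / r)) ^ r
        = ENNReal.ofReal (‖f y‖ ^ r * ‖g (y⁻¹ * x)‖) := by
      intro y
      rw [ENNReal.mul_rpow_of_nonneg _ _ hr0.le, ← ENNReal.rpow_mul, one_div_mul_cancel hr0.ne',
        ENNReal.rpow_one, ENNReal.ofReal_mul (by positivity),
        ← ENNReal.ofReal_rpow_of_nonneg (norm_nonneg _) hr0.le, ofReal_norm,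
        ofReal_norm]
    have h4 : ∫⁻ y, (‖g (y⁻¹ * x)‖ₑ ^ (1 / q)) ^ q ∂μ = A := by
      simp_rw [← ENNReal.rpow_mul, one_div_mul_cancel hq0.ne', ENNReal.rpow_one]
      exact (measurePreserving_inv_mul μ x).lintegral_comp hg.measurable.enorm
    rw [h4] at h2
    simp_rw [h3] at h2
    calc ‖conv μ f g x‖ₑ ^ r ≤ _ := ENNReal.rpow_le_rpow (h1.trans h2) hr0.le
      _ = _ := by
        rw [ENNReal.mul_rpow_of_nonneg _ _ hr0.le, ← ENNReal.rpow_mul, one_div_mul_cancel hr0.ne',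
          ENNReal.rpow_one, ← ENNReal.rpow_mul, one_div_mul_eq_div]
  have hfrs : HasCompactSupport fun y => ‖f y‖ ^ r :=
    hfs.comp_left (g := fun z : ℂ => ‖z‖ ^ r) (by simp [hr0.ne'])
  have hfr : Continuous fun y => ‖f y‖ ^ r := hf.norm.rpow_const fun _ => Or.inr hr0.le
  -- Measurability in `x` comes from continuity of the corresponding Bochner integral, not from
  -- measurability on the product.
  have hmeas : AEMeasurable (fun x => ∫⁻ y, ENNReal.ofReal (‖f y‖ ^ r * ‖g (y⁻¹ * x)‖) ∂μ) μ := by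
    have : (fun x => ∫⁻ y, ENNReal.ofReal (‖f y‖ ^ r * ‖g (y⁻¹ * x)‖) ∂μ)
        = fun x => ENNReal.ofReal (∫ y, ‖f y‖ ^ r * ‖g (y⁻¹ * x)‖ ∂μ) := by
      funext x
      rw [ofReal_integral_eq_lintegral_ofReal]
      · exact Continuous.integrable_of_hasCompactSupport (by fun_prop) hfrs.mul_right
      · exact Eventually.of_forall fun y => by positivity
    rw [this]
    exact (continuous_integral_mul_inv_mul hfr hfrs hg.norm).measurable.ennreal_ofReal.aemeasurable
  have key : ∫⁻ x, ‖conv μ f g x‖ₑ ^ r ∂μ ≤ (∫⁻ y, ‖f y‖ₑ ^ r ∂μ) * A ^ r := by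
    calc ∫⁻ x, ‖conv μ f g x‖ₑ ^ r ∂μ
        ≤ ∫⁻ x, (∫⁻ y, ENNReal.ofReal (‖f y‖ ^ r * ‖g (y⁻¹ * x)‖) ∂μ) * A ^ (r / q) ∂μ :=
          lintegral_mono hpt
      _ = (∫⁻ x, ∫⁻ y, ENNReal.ofReal (‖f y‖ ^ r * ‖g (y⁻¹ * x)‖) ∂μ ∂μ) * A ^ (r / q) :=
          lintegral_mul_const'' _ hmeas
      _ = (∫⁻ y, ENNReal.ofReal (‖f y‖ ^ r) ∂μ) * (∫⁻ y, ENNReal.ofReal ‖g y‖ ∂μ)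
            * A ^ (r / q) := by
          rw [lintegral_lintegral_mul_inv_mul (u := fun y => ‖f y‖ ^ r) (v := fun y => ‖g y‖)
            hfr hfrs (fun y => by simp only [Pi.zero_apply]; positivity) hg.norm hgs.norm
            (fun y => norm_nonneg _)]
      _ = (∫⁻ y, ‖f y‖ₑ ^ r ∂μ) * A ^ r := by
          -- Conjugacy of the exponents lets the factors `A` and `A ^ (r / q)` combine to `A ^ r`.
          have h5 : r = 1 + r / q := by
            have := hrq.inv_add_inv_eq_one
            field_simp at this ⊢
            linarith
          conv_rhs => rw [h5, ENNReal.rpow_add_of_nonneg _ _ zero_le_one (by positivity),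
            ENNReal.rpow_one]
          rw [← h5, mul_assoc]
          simp_rw [← ENNReal.ofReal_rpow_of_nonneg (norm_nonneg _) hr0.le, ofReal_norm]
          rfl
  rw [eLpNorm_eq_lintegral_rpow_enorm_toReal hp0 hp_top,
    eLpNorm_eq_lintegral_rpow_enorm_toReal hp0 hp_top, eLpNorm_one_eq_lintegral_enorm]
  calc _ ≤ ((∫⁻ y, ‖f y‖ₑ ^ r ∂μ) * A ^ r) ^ (1 / r) :=
        ENNReal.rpow_le_rpow key (by positivity)
    _ = _ := by
        rw [ENNReal.mul_rpow_of_nonneg _ _ (by positivity), ← ENNReal.rpow_mul A,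
          mul_one_div_cancel hr0.ne', ENNReal.rpow_one]

end CompactSupport

/-! ### Pointwise continuity of convolution in each factor -/

section Unimodular

variable {G : Type*} [Group G] [TopologicalSpace G] [IsTopologicalGroup G]
  [MeasurableSpace G] [BorelSpace G] {μ : Measure G} [μ.IsMulLeftInvariant] [μ.IsInvInvariant]

/-- Hölder bounds the convolution of the difference at every point, so norm convergence of a factor
gives convergence everywhere, not only almost everywhere. -/
theorem tendsto_conv_left {a b : ℝ≥0∞} [ENNReal.HolderTriple a b 1] {ι : Type*} {l : Filter ι}
    {u : ι → G → ℂ} {f g : G → ℂ} (hu : ∀ i, MemLp (u i) a μ) (hf : MemLp f a μ)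
    (hg : MemLp g b μ) (h : Tendsto (fun i => eLpNorm (u i - f) a μ) l (𝓝 0)) (x : G) :
    Tendsto (fun i => conv μ (u i) g x) l (𝓝 (conv μ f g x)) := by
  rw [tendsto_iff_edist_tendsto_0]
  have h2 : Tendsto (fun i => eLpNorm (u i - f) a μ * eLpNorm g b μ) l (𝓝 0) := by
    simpa using ENNReal.Tendsto.mul_const h (Or.inr hg.eLpNorm_ne_top)
  refine tendsto_of_tendsto_of_tendsto_of_le_of_le tendsto_const_nhds h2 (fun _ => zero_le)
    fun i => ?_
  rw [edist_eq_enorm_sub, ← Pi.sub_apply, ← conv_sub_left (hu i) hf hg]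
  exact enorm_conv_le ((hu i).sub hf).1 hg.1 x

theorem tendsto_conv_right {a b : ℝ≥0∞} [ENNReal.HolderTriple a b 1] {ι : Type*} {l : Filter ι}
    {u : ι → G → ℂ} {f g : G → ℂ} (hf : MemLp f a μ) (hu : ∀ i, MemLp (u i) b μ)
    (hg : MemLp g b μ) (h : Tendsto (fun i => eLpNorm (u i - g) b μ) l (𝓝 0)) (x : G) :
    Tendsto (fun i => conv μ f (u i) x) l (𝓝 (conv μ f g x)) := by
  rw [tendsto_iff_edist_tendsto_0]
  have h2 : Tendsto (fun i => eLpNorm f a μ * eLpNorm (u i - g) b μ) l (𝓝 0) := by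
    simpa using ENNReal.Tendsto.const_mul h (Or.inr hf.eLpNorm_ne_top)
  refine tendsto_of_tendsto_of_tendsto_of_le_of_le tendsto_const_nhds h2 (fun _ => zero_le)
    fun i => ?_
  rw [edist_eq_enorm_sub, ← Pi.sub_apply, ← conv_sub_right hf (hu i) hg]
  exact enorm_conv_le hf.1 ((hu i).sub hg).1 x

end Unimodular

/-! ### Density of `C_c` in `L^p` -/

section Density

variable {X : Type*} [TopologicalSpace X] [R1Space X] [LocallyCompactSpace X] [MeasurableSpace X]
  [BorelSpace X] {μ : Measure X} [μ.Regular] {p : ℝ≥0∞}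

/-- Density of `C_c` in `L^p` for a regular measure on a locally compact space; unlike
`MemLp.exists_hasCompactSupport_eLpNorm_sub_le` it does not assume that the space is normal. -/
theorem exists_hasCompactSupport_eLpNorm_sub_le (hp : p ≠ ∞) {f : X → ℂ} (hf : MemLp f p μ)
    {ε : ℝ≥0∞} (hε : ε ≠ 0) :
    ∃ g : X → ℂ, eLpNorm (f - g) p μ ≤ ε ∧ Continuous g ∧ HasCompactSupport g := by
  refine hf.induction_dense hp (fun g => Continuous g ∧ HasCompactSupport g) ?_ ?_ ?_ hε
  rotate_left
  · exact fun f g hf hg => ⟨hf.1.add hg.1, hf.2.add hg.2⟩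
  · exact fun f hf => (hf.1.memLp_of_hasCompactSupport (μ := μ) (p := p) hf.2).1
  intro c t ht htμ ε hε
  rcases exists_Lp_half ℂ μ p hε with ⟨δ, δpos, hδ⟩
  obtain ⟨η, ηpos, hη⟩ := exists_eLpNorm_indicator_le (μ := μ) hp c δpos.ne'
  have hη_pos' : (0 : ℝ≥0∞) < η := ENNReal.coe_pos.2 ηpos
  -- The indicator of `t` is compared with that of a compact `s ⊆ t`, and the latter with a Urysohn
  -- function supported in an open `V ⊇ s`. The errors live on `t \ s` and `V \ s`, both of measure
  -- below `η`.
  obtain ⟨s, st, s_compact, s_closed, μs⟩ :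
      ∃ s, s ⊆ t ∧ IsCompact s ∧ IsClosed s ∧ μ (t \ s) < η :=
    ht.exists_isCompact_isClosed_sdiff_lt htμ.ne hη_pos'.ne'
  have hsμ : μ s < ∞ := (measure_mono st).trans_lt htμ
  obtain ⟨V, sV, V_open, -, hV⟩ : ∃ V ⊇ s, IsOpen V ∧ μ V < ∞ ∧ μ (V \ s) < η :=
    s_closed.measurableSet.exists_isOpen_sdiff_lt hsμ.ne hη_pos'.ne'
  obtain ⟨k, hk1, hks, hkV, hk01⟩ :=
    exists_continuousMap_one_of_isCompact_subset_isOpen s_compact V_open sV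
  have hgs : HasCompactSupport fun x => (k x : ℂ) * c :=
    HasCompactSupport.mul_right (HasCompactSupport.comp_left (g := Complex.ofReal) hks rfl)
  have hg : Continuous fun x => (k x : ℂ) * c := by fun_prop
  have hgm := (hg.memLp_of_hasCompactSupport (μ := μ) (p := p) hgs).1
  have I1 : eLpNorm ((s.indicator fun _y => c) - t.indicator fun _y => c) p μ ≤ δ := by
    rw [← eLpNorm_neg, neg_sub, ← indicator_sdiff st]
    exact hη _ μs.le
  have I2 : eLpNorm ((fun x => (k x : ℂ) * c) - s.indicator fun _y => c) p μ ≤ δ := by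
    refine (eLpNorm_mono fun x => ?_).trans (hη _ hV.le)
    by_cases hs : x ∈ s
    · have : k x = 1 := hk1 hs
      simp [hs, this]
    · by_cases hv : x ∈ V
      · have h1 : x ∈ V \ s := ⟨hv, hs⟩
        simp only [Pi.sub_apply, hs, not_false_iff, indicator_of_notMem, sub_zero,
          indicator_of_mem h1, norm_mul, Complex.norm_real, Real.norm_of_nonneg (hk01 x).1]
        exact mul_le_of_le_one_left (norm_nonneg _) (hk01 x).2
      · have : k x = 0 := image_eq_zero_of_notMem_tsupport fun h => hv (hkV h)
        simp [hs, this]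
  refine ⟨_, ?_, hg, hgs⟩
  have h := (hδ _ _ (hgm.sub (aestronglyMeasurable_const.indicator s_closed.measurableSet))
    ((aestronglyMeasurable_const.indicator s_closed.measurableSet).sub
      (aestronglyMeasurable_const.indicator ht)) I2 I1).le
  rwa [sub_add_sub_cancel] at h

theorem exists_seq_hasCompactSupport_tendsto (hp_top : p ≠ ∞) {f : X → ℂ}
    (hf : MemLp f p μ) :
    ∃ u : ℕ → X → ℂ, (∀ n, Continuous (u n)) ∧ (∀ n, HasCompactSupport (u n)) ∧
      Tendsto (fun n => eLpNorm (u n - f) p μ) atTop (𝓝 0) := by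
  have h : ∀ n : ℕ, ∃ g : X → ℂ, eLpNorm (f - g) p μ ≤ ((n : ℝ≥0∞))⁻¹ ∧ Continuous g ∧
      HasCompactSupport g := fun n =>
    exists_hasCompactSupport_eLpNorm_sub_le hp_top hf
      (ENNReal.inv_ne_zero.2 (ENNReal.natCast_ne_top n))
  choose u h1 h2 h3 using h
  refine ⟨u, h2, h3, ?_⟩
  refine tendsto_of_tendsto_of_tendsto_of_le_of_le tendsto_const_nhds
    ENNReal.tendsto_inv_nat_nhds_zero (fun _ => zero_le) fun n => ?_
  rw [eLpNorm_sub_comm]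
  exact h1 n

end Density

/-! ### Young's inequality on `L^p` and membership of `C_c` in `L_p^T` -/

section Regular

variable {G : Type*} [Group G] [TopologicalSpace G] [IsTopologicalGroup G]
  [LocallyCompactSpace G] [MeasurableSpace G] [BorelSpace G] {μ : Measure G} [μ.IsMulLeftInvariant]
  [μ.Regular] [μ.IsInvInvariant] {p : ℝ≥0∞}

/-- Young's inequality `‖f * g‖_p ≤ ‖f‖_p ‖g‖_1` for `f ∈ L^p` and `g` continuous of compact
support. -/
theorem eLpNorm_conv_le_mul_eLpNorm_one (hp : 1 < p) (hp_top : p ≠ ∞) {f g : G → ℂ}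
    (hf : MemLp f p μ) (hg : Continuous g) (hgs : HasCompactSupport g) :
    AEStronglyMeasurable (conv μ f g) μ ∧
      eLpNorm (conv μ f g) p μ ≤ eLpNorm f p μ * eLpNorm g 1 μ := by
  have : ENNReal.HolderTriple p (ENNReal.conjExponent p) 1 :=
    ENNReal.HolderConjugate.conjExponent hp.le
  obtain ⟨u, hu, hus, hlim⟩ := exists_seq_hasCompactSupport_tendsto hp_top hf
  have hum : ∀ n, MemLp (u n) p μ := fun n => (hu n).memLp_of_hasCompactSupport (hus n)
  have hgq : MemLp g (ENNReal.conjExponent p) μ := hg.memLp_of_hasCompactSupport hgs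
  -- The pointwise limit carries over measurability, and by Fatou also the bound known for `u n`.
  have hpt : ∀ x, Tendsto (fun n => conv μ (u n) g x) atTop (𝓝 (conv μ f g x)) :=
    tendsto_conv_left hum hf hgq hlim
  have hmeas : ∀ n, AEStronglyMeasurable (conv μ (u n) g) μ := fun n =>
    (continuous_conv (hu n) (hus n) hg).measurable.aestronglyMeasurable
  refine ⟨aestronglyMeasurable_of_tendsto_ae atTop hmeas (Eventually.of_forall hpt), ?_⟩
  have hlim2 : Tendsto (fun n => (eLpNorm f p μ + eLpNorm (u n - f) p μ) * eLpNorm g 1 μ) atTop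
      (𝓝 (eLpNorm f p μ * eLpNorm g 1 μ)) := by
    have h1 : Tendsto (fun n => eLpNorm f p μ + eLpNorm (u n - f) p μ) atTop
        (𝓝 (eLpNorm f p μ)) := by simpa using hlim.const_add (eLpNorm f p μ)
    exact ENNReal.Tendsto.mul_const h1
      (Or.inr (hg.memLp_of_hasCompactSupport (p := 1) hgs).eLpNorm_ne_top)
  calc eLpNorm (conv μ f g) p μ
      ≤ liminf (fun n => eLpNorm (conv μ (u n) g) p μ) atTop :=
        Lp.eLpNorm_lim_le_liminf_eLpNorm hmeas _ (Eventually.of_forall hpt)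
    _ ≤ liminf (fun n => (eLpNorm f p μ + eLpNorm (u n - f) p μ) * eLpNorm g 1 μ) atTop := by
        refine liminf_le_liminf (Eventually.of_forall fun n => ?_)
        refine (eLpNorm_conv_le_of_hasCompactSupport hp hp_top (hu n) (hus n) hg hgs).trans ?_
        gcongr
        have := eLpNorm_add_le hf.1 ((hum n).sub hf).1 hp.le
        rwa [add_sub_cancel] at this
    _ = _ := hlim2.liminf_eq

/-- Young's inequality `‖f * g‖_p ≤ ‖f‖_1 ‖g‖_p` for `f` continuous of compact support and
`g ∈ L^p`. -/
theorem eLpNorm_conv_le_eLpNorm_one_mul (hp : 1 < p) (hp_top : p ≠ ∞) {f g : G → ℂ}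
    (hf : Continuous f) (hfs : HasCompactSupport f) (hg : MemLp g p μ) :
    AEStronglyMeasurable (conv μ f g) μ ∧
      eLpNorm (conv μ f g) p μ ≤ eLpNorm f 1 μ * eLpNorm g p μ := by
  have hinv := Measure.measurePreserving_inv μ
  have hfi : Continuous fun y => f y⁻¹ := by fun_prop
  have hfis : HasCompactSupport fun y => f y⁻¹ := hfs.comp_homeomorph (Homeomorph.inv G)
  have hgi : MemLp (fun y => g y⁻¹) p μ := hg.comp_measurePreserving hinv
  obtain ⟨h1, h2⟩ := eLpNorm_conv_le_mul_eLpNorm_one hp hp_top hgi hfi hfis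
  have heq : conv μ f g = conv μ (fun y => g y⁻¹) (fun y => f y⁻¹) ∘ Inv.inv := by
    funext x
    exact conv_eq_conv_inv f g x
  rw [heq]
  refine ⟨h1.comp_measurePreserving hinv, ?_⟩
  rw [eLpNorm_comp_measurePreserving h1 hinv, mul_comm]
  refine h2.trans_eq ?_
  congr 1
  · exact eLpNorm_comp_measurePreserving hg.1 hinv
  · exact eLpNorm_comp_measurePreserving hf.measurable.aestronglyMeasurable hinv

/-- Young's inequality read as an operator bound. Both proofs that `G` is discrete exploit that the
`L^1` norm controls `‖·‖_p^T`. -/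
theorem enormT_toLp_le (hp : 1 < p) (hp_top : p ≠ ∞) {f : G → ℂ} (hf : Continuous f)
    (hfs : HasCompactSupport f) (hfm : MemLp f p μ) :
    enormT μ p (hfm.toLp f) ≤ eLpNorm f 1 μ := by
  refine iSup₂_le fun g hg => ?_
  rw [conv_congr_right _ hfm.coeFn_toLp]
  refine (eLpNorm_conv_le_mul_eLpNorm_one hp hp_top (Lp.memLp g) hf hfs).2.trans ?_
  have : eLpNorm g p μ ≤ 1 := by
    rw [← Lp.enorm_def]
    exact enorm_le_coe.2 hg
  calc _ ≤ 1 * eLpNorm f 1 μ := by gcongr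
    _ = _ := one_mul _

/-- Continuous functions of compact support belong to `L_p^T`. -/
theorem toLp_mem_carrier (hp : 1 < p) (hp_top : p ≠ ∞) {f : G → ℂ} (hf : Continuous f)
    (hfs : HasCompactSupport f) (hfm : MemLp f p μ) : hfm.toLp f ∈ carrier μ p := by
  have : ENNReal.HolderTriple p (ENNReal.conjExponent p) 1 :=
    ENNReal.HolderConjugate.conjExponent hp.le
  refine ⟨fun g => Eventually.of_forall fun x => ?_, ?_⟩
  · refine integrable_conv (a := p) (b := ENNReal.conjExponent p) (Lp.memLp g) ?_ x
    exact (hf.memLp_of_hasCompactSupport hfs).ae_eq hfm.coeFn_toLp.symm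
  · exact (enormT_toLp_le hp hp_top hf hfs hfm).trans_lt
      (hf.memLp_of_hasCompactSupport hfs).eLpNorm_lt_top

theorem normT_toLp_le (hp : 1 < p) (hp_top : p ≠ ∞) {f : G → ℂ} (hf : Continuous f)
    (hfs : HasCompactSupport f) (hfm : MemLp f p μ) :
    normT μ p (hfm.toLp f) ≤ (eLpNorm f 1 μ).toReal :=
  ENNReal.toReal_mono (hf.memLp_of_hasCompactSupport hfs).eLpNorm_ne_top
    (enormT_toLp_le hp hp_top hf hfs hfm)

end Regular

/-! ### Approximate identities, and concentration near the identity -/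

section Haar

variable {G : Type*} [Group G] [TopologicalSpace G] [IsTopologicalGroup G]
  [LocallyCompactSpace G] [MeasurableSpace G] [BorelSpace G] {μ : Measure G} [μ.IsHaarMeasure]
  {p : ℝ≥0∞}

/-- Convolution with a suitable nonnegative function of integral one moves a continuous function
of compact support by little in the uniform norm. -/
theorem exists_norm_conv_sub_le {f : G → ℂ} (hf : Continuous f) (hfs : HasCompactSupport f)
    {ε : ℝ} (hε : 0 < ε) :
    ∃ g : G → ℝ, Continuous g ∧ HasCompactSupport g ∧ 0 ≤ g ∧
      eLpNorm (fun y => (g y : ℂ)) 1 μ = 1 ∧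
      ∀ x, ‖conv μ (fun y => (g y : ℂ)) f x - f x‖ ≤ ε := by
  obtain ⟨V, hV, hVf⟩ : ∃ V ∈ 𝓝 (1 : G), ∀ y ∈ V, ∀ x, ‖f (y⁻¹ * x) - f x‖ ≤ ε := by
    -- In the right uniformity the distance from `y⁻¹ * x` to `x` is measured by `x * (y⁻¹ * x)⁻¹ =
    -- y`, so the estimate is uniform in `x`.
    let _ : UniformSpace G := IsTopologicalGroup.rightUniformSpace G
    have huc : UniformContinuous f := hf.uniformContinuous_of_tendsto_cocompact hfs.is_zero_at_infty
    have h1 := huc (Metric.dist_mem_uniformity hε)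
    rw [mem_map, uniformity_eq_comap_nhds_one', mem_comap] at h1
    obtain ⟨W, hW, hWs⟩ := h1
    refine ⟨W, hW, fun y hy x => ?_⟩
    have h2 : (y⁻¹ * x, x) ∈ (fun p : G × G => p.2 * p.1⁻¹) ⁻¹' W := by
      simpa using hy
    have h3 := hWs h2
    simp only [mem_preimage, mem_ofPred_eq] at h3
    rw [← dist_eq_norm]
    exact le_of_lt h3
  obtain ⟨k, hk1, hks, hkV, hk01⟩ := exists_continuousMap_one_of_isCompact_subset_isOpen
    (isCompact_singleton (x := (1 : G))) isOpen_interior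
    (singleton_subset_iff.2 (mem_interior_iff_mem_nhds.2 hV))
  have hk0 : 0 ≤ (k : G → ℝ) := fun x => (hk01 x).1
  have hkone : k 1 ≠ 0 := by
    have : k 1 = 1 := hk1 (mem_singleton _)
    simp [this]
  have hint : 0 < ∫ x, k x ∂μ :=
    k.continuous.integral_pos_of_hasCompactSupport_nonneg_nonzero hks hk0 hkone
  set c := ∫ x, k x ∂μ with hc
  set g : G → ℝ := fun x => c⁻¹ * k x with hg
  have hgc : Continuous g := by fun_prop
  have hgs : HasCompactSupport g := HasCompactSupport.mul_left hks
  have hg0 : 0 ≤ g := fun x => mul_nonneg (inv_nonneg.2 hint.le) (hk0 x)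
  have hgint : ∫ x, g x ∂μ = 1 := by
    rw [hg, integral_const_mul, ← hc, inv_mul_cancel₀ hint.ne']
  have hgi : Integrable g μ := hgc.integrable_of_hasCompactSupport hgs
  refine ⟨g, hgc, hgs, hg0, ?_, fun x => ?_⟩
  · rw [eLpNorm_one_eq_lintegral_enorm]
    have : ∀ y, ‖(g y : ℂ)‖ₑ = ENNReal.ofReal (g y) := fun y => by
      rw [← ofReal_norm, Complex.norm_real, Real.norm_of_nonneg (hg0 y)]
    simp_rw [this]
    rw [← ofReal_integral_eq_lintegral_ofReal hgi (Eventually.of_forall hg0), hgint,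
      ENNReal.ofReal_one]
  · have h1 : f x = ∫ y, (g y : ℂ) * f x ∂μ := by
      rw [integral_mul_const, integral_complex_ofReal, hgint, Complex.ofReal_one, one_mul]
    have hgsC : HasCompactSupport fun y => (g y : ℂ) := hgs.comp_left Complex.ofReal_zero
    have hi1 : Integrable (fun y => (g y : ℂ) * f (y⁻¹ * x)) μ :=
      Continuous.integrable_of_hasCompactSupport (by fun_prop) hgsC.mul_right
    have hi2 : Integrable (fun y => (g y : ℂ) * f x) μ :=
      Continuous.integrable_of_hasCompactSupport (by fun_prop) hgsC.mul_right
    conv_lhs => rw [h1]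
    rw [conv, ← integral_sub hi1 hi2]
    calc _ ≤ ∫ y, g y * ε ∂μ := by
          refine norm_integral_le_of_norm_le (hgi.mul_const ε) (Eventually.of_forall fun y => ?_)
          rw [← mul_sub, norm_mul, Complex.norm_real, Real.norm_of_nonneg (hg0 y)]
          by_cases hy : y ∈ V
          · exact mul_le_mul_of_nonneg_left (hVf y hy x) (hg0 y)
          · have : k y = 0 := image_eq_zero_of_notMem_tsupport
              fun h => hy (interior_subset (hkV h))
            simp [hg, this]
      _ = ε := by rw [integral_mul_const, hgint, one_mul]

/-- In a nondiscrete group there are functions in `C_c(G)` of `L^p` norm one and of arbitrarily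
small `L^1` norm. -/
theorem exists_eLpNorm_one_le_of_not_discreteTopology [μ.Regular] [T2Space G]
    (hG : ¬ DiscreteTopology G)
    (hp : 1 < p) (hp_top : p ≠ ∞) {ε : ℝ≥0∞} (hε : ε ≠ 0) :
    ∃ g : G → ℝ, Continuous g ∧ HasCompactSupport g ∧ 0 ≤ g ∧
      eLpNorm (fun y => (g y : ℂ)) p μ = 1 ∧ eLpNorm (fun y => (g y : ℂ)) 1 μ ≤ ε := by
  have hne : (𝓝[≠] (1 : G)).NeBot := by
    rw [neBot_iff]
    intro h
    exact hG (discreteTopology_of_isOpen_singleton_one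
      (isOpen_singleton_iff_punctured_nhds _ |>.2 h))
  have hμ1 : μ {(1 : G)} = 0 := measure_singleton 1
  have hp0 : p ≠ 0 := (zero_lt_one.trans hp).ne'
  -- The exponent in `‖h‖_1 ≤ ‖h‖_p μ(U)^(1 - 1/p)` for `h` supported in `U`; hence the requirement
  -- `μ U < ε ^ (1 / s)` below, which can be met because `{1}` is null.
  set s : ℝ := 1 - 1 / p.toReal with hs
  have hr1 : 1 < p.toReal := by
    rw [← ENNReal.toReal_one]
    exact (ENNReal.toReal_lt_toReal ENNReal.one_ne_top hp_top).2 hp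
  have hs0 : 0 < s := by
    rw [hs, sub_pos, div_lt_one (by linarith)]
    exact hr1
  obtain ⟨U, hU1, hUo, hUμ⟩ : ∃ U ⊇ {(1 : G)}, IsOpen U ∧ μ U < ε ^ (1 / s) :=
    Set.exists_isOpen_lt_of_lt _ _ (by
      rw [hμ1]
      exact pos_iff_ne_zero.2 (by simp [ENNReal.rpow_eq_zero_iff, hε, hs0, hs0.le]))
  obtain ⟨k, hk1, hks, hkU, hk01⟩ := exists_continuousMap_one_of_isCompact_subset_isOpen
    (isCompact_singleton (x := (1 : G))) hUo hU1
  set h : G → ℂ := fun y => (k y : ℂ) with hh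
  have hhc : Continuous h := by fun_prop
  have hhs : HasCompactSupport h := HasCompactSupport.comp_left (g := Complex.ofReal) hks rfl
  have hhm : MemLp h p μ := hhc.memLp_of_hasCompactSupport hhs
  have hnz : eLpNorm h p μ ≠ 0 := by
    rw [Ne, eLpNorm_eq_zero_iff hhm.1 hp0]
    intro h0
    have h1 : h = 0 := (hhc.ae_eq_iff_eq μ continuous_zero).1 h0
    have h2 : h 1 = 1 := by
      have : k 1 = 1 := hk1 (mem_singleton _)
      simp [hh, this]
    rw [h1] at h2
    simp at h2
  have hsupp : Function.support h ⊆ U := fun y hy => hkU (subset_tsupport _ fun h0 => hy (by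
    simp [hh, h0]))
  have hbound : eLpNorm h 1 μ ≤ eLpNorm h p μ * ε := by
    rw [← eLpNorm_restrict_eq_of_support_subset (p := 1) hsupp]
    refine (eLpNorm_le_eLpNorm_mul_rpow_measure_univ hp.le hhm.1.restrict).trans ?_
    rw [eLpNorm_restrict_eq_of_support_subset hsupp, Measure.restrict_apply_univ]
    gcongr
    rw [ENNReal.toReal_one, one_div_one, ← hs]
    calc μ U ^ s ≤ (ε ^ (1 / s)) ^ s := ENNReal.rpow_le_rpow hUμ.le hs0.le
      _ = ε := by rw [← ENNReal.rpow_mul, one_div_mul_cancel hs0.ne', ENNReal.rpow_one]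
  set a := (eLpNorm h p μ).toReal with ha
  have haE : ENNReal.ofReal a = eLpNorm h p μ := ENNReal.ofReal_toReal hhm.eLpNorm_ne_top
  have ha0 : 0 < a := ENNReal.toReal_pos hnz hhm.eLpNorm_ne_top
  have hsm : ∀ q, eLpNorm (fun y => ((a⁻¹ * k y : ℝ) : ℂ)) q μ
      = (eLpNorm h p μ)⁻¹ * eLpNorm h q μ := by
    intro q
    have : (fun y => ((a⁻¹ * k y : ℝ) : ℂ)) = ((a⁻¹ : ℝ) : ℂ) • h := by
      funext y
      simp [hh]
    rw [this, eLpNorm_const_smul, ← ofReal_norm, Complex.norm_real,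
      Real.norm_of_nonneg (inv_nonneg.2 ha0.le), ENNReal.ofReal_inv_of_pos ha0, haE]
  refine ⟨fun y => a⁻¹ * k y, by fun_prop, HasCompactSupport.mul_left hks,
    fun y => mul_nonneg (inv_nonneg.2 ha0.le) (hk01 y).1, ?_, ?_⟩
  · rw [hsm, ENNReal.inv_mul_cancel hnz hhm.eLpNorm_ne_top]
  · rw [hsm]
    calc _ ≤ (eLpNorm h p μ)⁻¹ * (eLpNorm h p μ * ε) := by gcongr
      _ = ε := by
        rw [← mul_assoc, ENNReal.inv_mul_cancel hnz hhm.eLpNorm_ne_top, one_mul]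

/-- On a nondiscrete group some `f ∈ C_c(G)` has `‖f‖_p = 1` and `‖f‖_p^T ≤ ‖f‖_1 ≤ 1 / (2K)`, so
the assumed bound would give `1 ≤ 1 / 2`. -/
theorem discreteTopology_of_norm_le_normT [μ.Regular] [T2Space G] [μ.IsInvInvariant]
    (hp : 1 < p) (hp_top : p ≠ ∞)
    (h : ∃ K > 0, ∀ f ∈ carrier μ p, ‖f‖ ≤ K * normT μ p f) : DiscreteTopology G := by
  obtain ⟨K, hK, hKf⟩ := h
  by_contra hG
  obtain ⟨g, hg, hgs, -, hgp, hg1⟩ := exists_eLpNorm_one_le_of_not_discreteTopology (μ := μ) hG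
    hp hp_top (ε := ENNReal.ofReal (1 / (2 * K))) (by simpa using hK)
  set f : G → ℂ := fun y => (g y : ℂ)
  have hf : Continuous f := by fun_prop
  have hfs : HasCompactSupport f := hgs.comp_left Complex.ofReal_zero
  have hfm : MemLp f p μ := hf.memLp_of_hasCompactSupport hfs
  have h1 := hKf _ (toLp_mem_carrier hp hp_top hf hfs hfm)
  have h2 := normT_toLp_le hp hp_top hf hfs hfm
  have h3 : (eLpNorm f 1 μ).toReal ≤ 1 / (2 * K) :=
    ENNReal.toReal_le_of_le_ofReal (by positivity) hg1
  rw [Lp.norm_toLp, hgp, ENNReal.toReal_one] at h1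
  have h4 : K * normT μ p (hfm.toLp f) ≤ K * (1 / (2 * K)) :=
    mul_le_mul_of_nonneg_left (h2.trans h3) hK.le
  have h5 : K * (1 / (2 * K)) = 1 / 2 := by field_simp
  linarith

end Haar

/-! ### Monotonicity of convolution with a nonnegative function -/

section Monotone

variable {G : Type*} [Group G] [TopologicalSpace G] [IsTopologicalGroup G]
  [MeasurableSpace G] [BorelSpace G] {μ : Measure G} [IsFiniteMeasureOnCompacts μ]

theorem norm_conv_ofReal_le {g f f' : G → ℝ} (hg : Continuous g) (hgs : HasCompactSupport g)
    (hg0 : 0 ≤ g) (hf : Continuous f) (hf0 : 0 ≤ f) (hf' : Continuous f')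
    (hle : f ≤ f') (x : G) :
    ‖conv μ (fun y => (g y : ℂ)) (fun y => (f y : ℂ)) x‖
      ≤ ‖conv μ (fun y => (g y : ℂ)) (fun y => (f' y : ℂ)) x‖ := by
  have h1 : ∀ h : G → ℝ, 0 ≤ h → ‖conv μ (fun y => (g y : ℂ)) (fun y => (h y : ℂ)) x‖
      = ∫ y, g y * h (y⁻¹ * x) ∂μ := by
    intro h h0
    have : conv μ (fun y => (g y : ℂ)) (fun y => (h y : ℂ)) x
        = ((∫ y, g y * h (y⁻¹ * x) ∂μ : ℝ) : ℂ) := by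
      rw [conv, ← integral_complex_ofReal]
      simp
    rw [this, Complex.norm_real, Real.norm_of_nonneg]
    exact integral_nonneg fun y => mul_nonneg (hg0 _) (h0 _)
  rw [h1 f hf0, h1 f' (hf0.trans hle)]
  refine integral_mono ?_ ?_ fun y => mul_le_mul_of_nonneg_left (hle _) (hg0 _)
  · exact Continuous.integrable_of_hasCompactSupport (by fun_prop) hgs.mul_right
  · exact Continuous.integrable_of_hasCompactSupport (by fun_prop) hgs.mul_right

end Monotone

/-! ### Completeness forces discreteness -/

section Haar

variable {G : Type*} [Group G] [TopologicalSpace G] [IsTopologicalGroup G]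
  [LocallyCompactSpace G] [MeasurableSpace G] [BorelSpace G] {μ : Measure G} [μ.IsHaarMeasure]
  [μ.Regular] {p : ℝ≥0∞}

/-- If continuous functions of compact support `u n` that dominate `f ≥ 0` converge to `a` in
`‖·‖_p^T`, then `‖f‖_p ≤ ‖a‖_p`. -/
theorem eLpNorm_le_of_normT_tendsto [μ.IsInvInvariant] [Fact (1 ≤ p)] (hp : 1 < p) (hp_top : p ≠ ∞)
    {f : G → ℝ}
    (hf : Continuous f) (hfs : HasCompactSupport f) (hf0 : 0 ≤ f) {u : ℕ → G → ℝ}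
    (hu : ∀ n, Continuous (u n)) (hfu : ∀ᶠ n in atTop, f ≤ u n)
    (hum : ∀ n, MemLp (fun y => (u n y : ℂ)) p μ) {a : Lp ℂ p μ}
    (hmem : ∀ n, (hum n).toLp _ - a ∈ carrier μ p)
    (hlim : Tendsto (fun n => normT μ p ((hum n).toLp _ - a)) atTop (𝓝 0)) :
    eLpNorm (fun y => (f y : ℂ)) p μ ≤ eLpNorm a p μ := by
  have : ENNReal.HolderConjugate p (ENNReal.conjExponent p) :=
    ENNReal.HolderConjugate.conjExponent hp.le
  have hq : ENNReal.HolderTriple (ENNReal.conjExponent p) p 1 :=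
    ENNReal.HolderConjugate.symm
  set fC : G → ℂ := fun y => (f y : ℂ) with hfC
  have hfCc : Continuous fC := by fun_prop
  have hfCs : HasCompactSupport fC := hfs.comp_left Complex.ofReal_zero
  -- Positivity gives `g * f ≤ g * u n = g * (u n - a) + g * a`. The first term has norm at most
  -- `‖g‖_p ‖u n - a‖_p^T`, which tends to zero; the second is at most `‖g‖_1 ‖a‖_p = ‖a‖_p` by
  -- Young.
  have key : ∀ g : G → ℝ, Continuous g → HasCompactSupport g → 0 ≤ g →
      eLpNorm (fun y => (g y : ℂ)) 1 μ = 1 →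
      eLpNorm (conv μ (fun y => (g y : ℂ)) fC) p μ ≤ eLpNorm a p μ := by
    intro g hg hgs hg0 hg1
    set gC : G → ℂ := fun y => (g y : ℂ) with hgC
    have hgCc : Continuous gC := by fun_prop
    have hgCs : HasCompactSupport gC := hgs.comp_left Complex.ofReal_zero
    have hgm : MemLp gC p μ := hgCc.memLp_of_hasCompactSupport hgCs
    have hgq : MemLp gC (ENNReal.conjExponent p) μ := hgCc.memLp_of_hasCompactSupport hgCs
    have hlim2 : Tendsto (fun n => ENNReal.ofReal (‖hgm.toLp gC‖ *
        normT μ p ((hum n).toLp _ - a)) + eLpNorm a p μ) atTop (𝓝 (eLpNorm a p μ)) := by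
      have h1 : Tendsto (fun n => ‖hgm.toLp gC‖ * normT μ p ((hum n).toLp _ - a)) atTop
          (𝓝 0) := by simpa using hlim.const_mul ‖hgm.toLp gC‖
      simpa using (ENNReal.tendsto_ofReal h1).add_const (eLpNorm a p μ)
    refine ge_of_tendsto hlim2 ?_
    filter_upwards [hfu] with n hn
    have hdm : MemLp ((fun y => (u n y : ℂ)) - (a : G → ℂ)) p μ := (hum n).sub (Lp.memLp a)
    have hsplit : conv μ gC (fun y => (u n y : ℂ))
        = conv μ gC ((fun y => (u n y : ℂ)) - (a : G → ℂ)) + conv μ gC a := by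
      rw [← conv_add_right hgq hdm (Lp.memLp a), sub_add_cancel]
    obtain ⟨hm1, -⟩ := eLpNorm_conv_le_eLpNorm_one_mul hp hp_top hgCc hgCs hdm
    obtain ⟨hm2, hb2⟩ := eLpNorm_conv_le_eLpNorm_one_mul hp hp_top hgCc hgCs (Lp.memLp a)
    rw [hg1, one_mul] at hb2
    have hb1 : eLpNorm (conv μ gC ((fun y => (u n y : ℂ)) - (a : G → ℂ))) p μ
        ≤ ENNReal.ofReal (‖hgm.toLp gC‖ * normT μ p ((hum n).toLp _ - a)) := by
      have h1 := eLpNorm_conv_le_normT (hgm.toLp gC) (hmem n)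
      rwa [conv_congr_left hgm.coeFn_toLp, conv_congr_right gC
        ((Lp.coeFn_sub _ _).trans ((hum n).coeFn_toLp.sub (EventuallyEq.refl _ _)))] at h1
    calc eLpNorm (conv μ gC fC) p μ ≤ eLpNorm (conv μ gC fun y => (u n y : ℂ)) p μ :=
          eLpNorm_mono (norm_conv_ofReal_le hg hgs hg0 hf hf0 (hu n) hn)
      _ ≤ _ := by
          rw [hsplit]
          exact (eLpNorm_add_le hm1 hm2 hp.le).trans (add_le_add hb1 hb2)
  -- Letting `g` run through an approximate identity, `g * f` tends to `f` pointwise, and Fatou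
  -- removes `g` from the bound.
  have happ : ∀ k : ℕ, ∃ g : G → ℝ, Continuous g ∧ HasCompactSupport g ∧ 0 ≤ g ∧
      eLpNorm (fun y => (g y : ℂ)) 1 μ = 1 ∧
      ∀ x, ‖conv μ (fun y => (g y : ℂ)) fC x - fC x‖ ≤ 1 / ((k : ℝ) + 1) := fun k =>
    exists_norm_conv_sub_le hfCc hfCs Nat.one_div_pos_of_nat
  choose g hg hgs hg0 hg1 hgf using happ
  refine Lp.eLpNorm_le_of_ae_tendsto (u := atTop)
    (f := fun k => conv μ (fun y => (g k y : ℂ)) fC)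
    (Eventually.of_forall fun k => key _ (hg k) (hgs k) (hg0 k) (hg1 k)) (fun k => ?_)
    (Eventually.of_forall fun x => ?_)
  · exact (continuous_conv (by have := hg k; fun_prop)
      ((hgs k).comp_left Complex.ofReal_zero) hfCc).measurable.aestronglyMeasurable
  · rw [tendsto_iff_norm_sub_tendsto_zero]
    exact squeeze_zero (fun _ => norm_nonneg _) (fun k => hgf k x)
      tendsto_one_div_add_atTop_nhds_zero_nat

theorem exists_seq_eLpNorm_one_le [T2Space G] (hG : ¬ DiscreteTopology G) (hp : 1 < p)
    (hp_top : p ≠ ∞) :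
    ∃ φ : ℕ → G → ℝ, (∀ n, Continuous (φ n)) ∧ (∀ n, HasCompactSupport (φ n)) ∧ (∀ n, 0 ≤ φ n) ∧
      (∀ n, eLpNorm (fun y => (φ n y : ℂ)) p μ = ENNReal.ofReal (2 ^ n)) ∧
      ∀ n, eLpNorm (fun y => (φ n y : ℂ)) 1 μ ≤ ENNReal.ofReal ((1 / 2) ^ n) := by
  -- The bound `4^(-n)` leaves `2^(-n)` after scaling by `2^n`: summable in `L^1`, unbounded in
  -- `L^p`.
  have hex : ∀ n : ℕ, ∃ g : G → ℝ, Continuous g ∧ HasCompactSupport g ∧ 0 ≤ g ∧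
      eLpNorm (fun y => (g y : ℂ)) p μ = 1 ∧
      eLpNorm (fun y => (g y : ℂ)) 1 μ ≤ ENNReal.ofReal ((1 / 4) ^ n) := fun n =>
    exists_eLpNorm_one_le_of_not_discreteTopology hG hp hp_top (by simp)
  choose g hg hgs hg0 hgp hg1 using hex
  let φ : ℕ → G → ℝ := fun n y => 2 ^ n * g n y
  have hφc : ∀ n, Continuous (φ n) := fun n => (hg n).const_mul _
  have hφs : ∀ n, HasCompactSupport (φ n) := fun n => (hgs n).mul_left
  have hφ0 : ∀ n, 0 ≤ φ n := fun n y => mul_nonneg (by positivity) (hg0 n y)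
  have hφq : ∀ n q, eLpNorm (fun y => (φ n y : ℂ)) q μ
      = ENNReal.ofReal (2 ^ n) * eLpNorm (fun y => (g n y : ℂ)) q μ := by
    intro n q
    have : (fun y => (φ n y : ℂ)) = (((2 : ℝ) ^ n : ℝ) : ℂ) • fun y => (g n y : ℂ) := by
      funext y
      simp [φ]
    rw [this, eLpNorm_const_smul, ← ofReal_norm, Complex.norm_real,
      Real.norm_of_nonneg (by positivity)]
  have hφ1 : ∀ n, eLpNorm (fun y => (φ n y : ℂ)) 1 μ ≤ ENNReal.ofReal ((1 / 2) ^ n) := by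
    intro n
    rw [hφq]
    calc _ ≤ ENNReal.ofReal (2 ^ n) * ENNReal.ofReal ((1 / 4) ^ n) := by gcongr; exact hg1 n
      _ = ENNReal.ofReal ((1 / 2) ^ n) := by
        rw [← ENNReal.ofReal_mul (by positivity), ← mul_pow]
        norm_num
  exact ⟨φ, hφc, hφs, hφ0, fun n => by rw [hφq, hgp, mul_one], hφ1⟩

/-- The product plays no role: the contradiction comes from a Cauchy sequence of partial sums whose
limit would have too large an `L^p` norm. -/
theorem discreteTopology_of_isConvBanachAlgebra [μ.IsInvInvariant] [T2Space G] (hp : 1 < p)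
    (hp_top : p ≠ ∞)
    (h : IsConvBanachAlgebra μ p) : DiscreteTopology G := by
  by_contra hG
  have : Fact (1 ≤ p) := ⟨hp.le⟩
  obtain ⟨S, hS, mul, -, hB⟩ := h
  obtain ⟨φ, hφc, hφs, hφ0, hφp, hφ1⟩ := exists_seq_eLpNorm_one_le (μ := μ) hG hp hp_top
  obtain ⟨s, hs⟩ : ∃ s : ℕ → G → ℝ, s = fun N y => ∑ k ∈ Finset.range N, φ k y := ⟨_, rfl⟩
  have hss : ∀ N y, s (N + 1) y = s N y + φ N y := fun N y => by
    rw [hs]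
    exact Finset.sum_range_succ _ _
  have hsc : ∀ N, Continuous (s N) := fun N => by
    rw [hs]
    exact continuous_finsetSum _ fun k _ => hφc k
  have hsS : ∀ N, HasCompactSupport (s N) := by
    intro N
    induction N with
    | zero =>
      rw [hs]
      exact (HasCompactSupport.zero : HasCompactSupport (0 : G → ℝ))
    | succ N ih =>
      have : s (N + 1) = s N + φ N := funext (hss N)
      rw [this]
      exact ih.add (hφs N)
  have hsCc : ∀ N, Continuous fun y => (s N y : ℂ) := fun N => by
    have := hsc N
    fun_prop
  have hsCs : ∀ N, HasCompactSupport fun y => (s N y : ℂ) := fun N =>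
    (hsS N).comp_left Complex.ofReal_zero
  have hsm : ∀ q N, MemLp (fun y => (s N y : ℂ)) q μ := fun q N =>
    (hsCc N).memLp_of_hasCompactSupport (hsCs N)
  have hcau : CauchySeq fun N => (hsm 1 N).toLp _ := by
    refine cauchySeq_of_le_geometric (1 / 2) 1 (by norm_num) fun n => ?_
    rw [dist_comm, dist_eq_norm, ← MemLp.toLp_sub, Lp.norm_toLp, one_mul]
    refine ENNReal.toReal_le_of_le_ofReal (by positivity) ?_
    convert hφ1 n using 2
    funext y
    simp [hss]
  have hmem : ∀ N, (hsm p N).toLp _ ∈ S := fun N => by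
    rw [← SetLike.mem_coe, hS]
    exact toLp_mem_carrier hp hp_top (hsCc N) (hsCs N) _
  obtain ⟨a, ha⟩ := hB.complete (fun N => ⟨_, hmem N⟩) (by
    intro ε hε
    obtain ⟨N, hN⟩ := Metric.cauchySeq_iff.1 hcau ε hε
    refine ⟨N, fun m hm n hn => ?_⟩
    have h1 := hN m hm n hn
    rw [dist_eq_norm, ← MemLp.toLp_sub, Lp.norm_toLp] at h1
    refine lt_of_le_of_lt ?_ h1
    simp only [AddSubgroupClass.coe_sub]
    rw [← MemLp.toLp_sub]
    exact normT_toLp_le hp hp_top ((hsCc m).sub (hsCc n)) ((hsCs m).sub (hsCs n)) _)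
  have hlim : Tendsto (fun n => normT μ p ((hsm p n).toLp _ - (a : Lp ℂ p μ))) atTop (𝓝 0) := by
    rw [Metric.tendsto_atTop]
    intro ε hε
    obtain ⟨n₀, h⟩ := ha ε hε
    refine ⟨n₀, fun n hn => ?_⟩
    rw [Real.dist_0_eq_abs, abs_of_nonneg (normT_nonneg _)]
    exact h n hn
  obtain ⟨N, hN⟩ := pow_unbounded_of_one_lt ‖(a : Lp ℂ p μ)‖ (one_lt_two (α := ℝ))
  have hmem2 : ∀ n, (hsm p n).toLp _ - (a : Lp ℂ p μ) ∈ carrier μ p := fun n => by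
    rw [← hS]
    exact S.sub_mem (hmem n) a.2
  -- The sum `s M` runs over `k < M`, so it contains the term `φ N` only from `M = N + 1` on.
  have hdom : ∀ M ≥ N + 1, φ N ≤ s M := fun M hM y => by
    rw [hs]
    exact Finset.single_le_sum (f := fun k => φ k y) (fun k _ => hφ0 k y) (Finset.mem_range.2 hM)
  have hle := eLpNorm_le_of_normT_tendsto hp hp_top (hφc N) (hφs N) (hφ0 N) hsc
    (eventually_atTop.2 ⟨N + 1, hdom⟩) (hsm p) (a := a)
    hmem2 hlim
  rw [hφp, ← Lp.enorm_def, ← ofReal_norm,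
    ENNReal.ofReal_le_ofReal_iff (norm_nonneg _)] at hle
  exact absurd hN (not_lt.2 hle)

end Haar

/-! ### Discrete groups: point masses, embedding into `L^2`, associativity -/

theorem aestronglyMeasurable_of_discrete {X : Type*} [TopologicalSpace X] [DiscreteTopology X]
    [MeasurableSpace X] [BorelSpace X] {μ : Measure X} (f : X → ℂ) : AEStronglyMeasurable f μ :=
  (continuous_of_discreteTopology (f := f)).measurable.aestronglyMeasurable

theorem eq_of_ae_eq_of_discrete {X : Type*} [TopologicalSpace X] [DiscreteTopology X]
    [MeasurableSpace X] {μ : Measure X} [μ.IsOpenPosMeasure] {f g : X → ℂ} (h : f =ᵐ[μ] g) :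
    f = g :=
  (continuous_of_discreteTopology.ae_eq_iff_eq μ continuous_of_discreteTopology).1 h

theorem measure_singleton_one_ne_zero_of_discrete {G : Type*} [Group G] [TopologicalSpace G]
    [DiscreteTopology G] [MeasurableSpace G] (μ : Measure G) [μ.IsHaarMeasure] :
    μ {(1 : G)} ≠ 0 :=
  (isOpen_discrete _).measure_ne_zero μ (singleton_nonempty _)

theorem memLp_conv_of_discrete {G : Type*} [Group G] [TopologicalSpace G] [DiscreteTopology G]
    [MeasurableSpace G] [BorelSpace G] {μ : Measure G} {p : ℝ≥0∞} [Fact (1 ≤ p)]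
    {h : G → ℂ} (hh : MemLp h p μ) {f : Lp ℂ p μ}
    (hf : f ∈ carrier μ p) : MemLp (conv μ h f) p μ :=
  ⟨aestronglyMeasurable_of_discrete _,
    (eLpNorm_conv_le_mul_enormT hh f).trans_lt (ENNReal.mul_lt_top hh.2 hf.2)⟩

section Discrete

variable {G : Type*} [Group G] [TopologicalSpace G] [MeasurableSpace G] [BorelSpace G]
  [DiscreteTopology G] [IsTopologicalGroup G] {μ : Measure G} [μ.IsHaarMeasure] {p : ℝ≥0∞}

theorem conv_eq_sum {u : G → ℂ} {T : Finset G} (hT : ∀ y ∉ T, u y = 0) (f : G → ℂ) (x : G) :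
    conv μ u f x = ∑ w ∈ T, μ.real {(1 : G)} • (u w * f (w⁻¹ * x)) := by
  rw [conv, ← setIntegral_eq_integral_of_forall_compl_eq_zero (s := (T : Set G))
    (fun y hy => by simp [hT y (by simpa using hy)]), setIntegral_finset]
  · simp only [measureReal_def, Measure.haar_singleton μ]
  · exact continuous_of_discreteTopology.continuousOn.integrableOn_compact
      T.finite_toSet.isCompact

/-- With `e` the indicator of `{1}` and `c` the mass of a point, `e * f = c f`, so `c ‖f‖_p ≤ ‖e‖_p
‖f‖_p^T`. Unimodularity is not needed. -/
theorem norm_le_mul_normT_of_discrete [Fact (1 ≤ p)] :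
    ∃ K > 0, ∀ f ∈ carrier μ p, ‖f‖ ≤ K * normT μ p f := by
  classical
  set c := μ.real {(1 : G)} with hc
  have hc0 : 0 < c := ENNReal.toReal_pos (measure_singleton_one_ne_zero_of_discrete μ)
    (isCompact_singleton.measure_ne_top)
  set e : G → ℂ := fun y => if y = 1 then 1 else 0 with he
  have hes : HasCompactSupport e := HasCompactSupport.intro (isCompact_singleton (x := (1 : G)))
    fun y hy => by simp [he, show y ≠ 1 from hy]
  have hem : MemLp e p μ := continuous_of_discreteTopology.memLp_of_hasCompactSupport hes
  -- Adding one makes the constant visibly positive without computing `‖e‖_p`.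
  refine ⟨(‖hem.toLp e‖ + 1) / c, by positivity, fun f hf => ?_⟩
  have h1 := eLpNorm_conv_le_normT (hem.toLp e) hf
  have h2 : conv μ (hem.toLp e) f = (c : ℂ) • (f : G → ℂ) := by
    rw [conv_congr_left hem.coeFn_toLp]
    funext x
    rw [conv_eq_sum (T := {1}) (fun y hy => by simpa [he] using hy)]
    simp [he, hc]
  have hcn : ‖(c : ℂ)‖ₑ = ENNReal.ofReal c := by
    rw [← ofReal_norm, Complex.norm_real, Real.norm_of_nonneg hc0.le]
  rw [h2, eLpNorm_const_smul, ← Lp.enorm_def, hcn, ← ofReal_norm,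
    ← ENNReal.ofReal_mul hc0.le, ENNReal.ofReal_le_ofReal_iff
      (mul_nonneg (norm_nonneg _) (normT_nonneg _))] at h1
  rw [div_mul_eq_mul_div, le_div_iff₀ hc0]
  have := normT_nonneg f
  nlinarith

/-- All points have the same positive finite mass, so restricting `f` to `{x}` bounds its value
there. -/
theorem exists_enorm_le_mul_eLpNorm (hp0 : p ≠ 0) (hp_top : p ≠ ∞) :
    ∃ C ≠ ∞, ∀ (f : G → ℂ) (x : G), ‖f x‖ₑ ≤ C * eLpNorm f p μ := by
  have h0 := measure_singleton_one_ne_zero_of_discrete μ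
  have ht : μ {(1 : G)} ≠ ∞ := isCompact_singleton.measure_ne_top
  set c := μ {(1 : G)} ^ (1 / p.toReal) with hc
  have hc0 : c ≠ 0 := by
    rw [hc, Ne, ENNReal.rpow_eq_zero_iff]
    simp [h0, ht]
  have hct : c ≠ ∞ := ENNReal.rpow_ne_top_of_nonneg (by positivity) ht
  refine ⟨c⁻¹, ENNReal.inv_ne_top.2 hc0, fun f x => ?_⟩
  have h1 : eLpNorm (({x} : Set G).indicator fun _ => f x) p μ ≤ eLpNorm f p μ := by
    refine le_trans (le_of_eq ?_) (eLpNorm_indicator_le (s := {x}) f)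
    congr 1
    funext y
    by_cases hy : y = x
    · simp [hy]
    · simp [hy]
  rw [eLpNorm_indicator_const (measurableSet_singleton x) hp0 hp_top,
    Measure.haar_singleton μ x, ← hc] at h1
  calc ‖f x‖ₑ = c⁻¹ * (‖f x‖ₑ * c) := by
        rw [mul_comm, mul_assoc, ENNReal.mul_inv_cancel hc0 hct, mul_one]
    _ ≤ _ := by gcongr

/-- On a discrete group `L^p` embeds into `L^2` for `p ≤ 2`. -/
theorem exists_eLpNorm_two_le (hp0 : p ≠ 0) (hp2 : p ≤ 2) :
    ∃ D ≠ ∞, ∀ f : G → ℂ, eLpNorm f 2 μ ≤ D * eLpNorm f p μ := by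
  have hp_top : p ≠ ∞ := (hp2.trans_lt ENNReal.ofNat_lt_top).ne
  obtain ⟨C, hC, hCf⟩ := exists_enorm_le_mul_eLpNorm (μ := μ) hp0 hp_top
  set r := p.toReal with hr
  have hr0 : 0 < r := ENNReal.toReal_pos hp0 hp_top
  have hr2 : r ≤ 2 := by
    rw [hr, ← ENNReal.toReal_ofNat 2]
    exact ENNReal.toReal_mono ENNReal.ofNat_ne_top hp2
  have hs : 0 ≤ 2 - r := by linarith
  refine ⟨(C ^ (2 - r)) ^ (1 / 2 : ℝ), ENNReal.rpow_ne_top_of_nonneg (by norm_num)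
    (ENNReal.rpow_ne_top_of_nonneg hs hC), fun f => ?_⟩
  set N := eLpNorm f p μ with hN
  have hNr : ∫⁻ x, ‖f x‖ₑ ^ r ∂μ = N ^ r := by
    rw [hN, eLpNorm_eq_lintegral_rpow_enorm_toReal hp0 hp_top, ← ENNReal.rpow_mul,
      one_div_mul_cancel hr0.ne', ENNReal.rpow_one]
  -- Write `|f|^2 = |f|^(2 - r) |f|^r` and bound the first factor by the uniform estimate; this
  -- needs `r ≤ 2`.
  have key : ∫⁻ x, ‖f x‖ₑ ^ (2 : ℝ) ∂μ ≤ C ^ (2 - r) * N ^ (2 : ℝ) := by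
    calc ∫⁻ x, ‖f x‖ₑ ^ (2 : ℝ) ∂μ ≤ ∫⁻ x, (C * N) ^ (2 - r) * ‖f x‖ₑ ^ r ∂μ := by
          refine lintegral_mono fun x => ?_
          calc ‖f x‖ₑ ^ (2 : ℝ) = ‖f x‖ₑ ^ (2 - r) * ‖f x‖ₑ ^ r := by
                rw [← ENNReal.rpow_add_of_nonneg _ _ hs hr0.le, sub_add_cancel]
            _ ≤ _ := by
                gcongr
                exact hCf f x
      _ = (C * N) ^ (2 - r) * N ^ r := by
          rw [lintegral_const_mul'' _ ((aestronglyMeasurable_of_discrete f).enorm.pow_const _), hNr]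
      _ = C ^ (2 - r) * N ^ (2 : ℝ) := by
          rw [ENNReal.mul_rpow_of_nonneg _ _ hs, mul_assoc,
            ← ENNReal.rpow_add_of_nonneg _ _ hs hr0.le, sub_add_cancel]
  rw [eLpNorm_eq_lintegral_rpow_enorm_toReal two_ne_zero ENNReal.ofNat_ne_top,
    ENNReal.toReal_ofNat]
  calc _ ≤ (C ^ (2 - r) * N ^ (2 : ℝ)) ^ (1 / 2 : ℝ) := ENNReal.rpow_le_rpow key (by norm_num)
    _ = _ := by
      rw [ENNReal.mul_rpow_of_nonneg _ _ (by norm_num), ← ENNReal.rpow_mul N]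
      norm_num

theorem memLp_two_of_discrete (hp0 : p ≠ 0) (hp2 : p ≤ 2) {f : G → ℂ} (hf : MemLp f p μ) :
    MemLp f 2 μ := by
  obtain ⟨D, hD, hDf⟩ := exists_eLpNorm_two_le (μ := μ) hp0 hp2
  exact ⟨hf.1, (hDf f).trans_lt (ENNReal.mul_lt_top hD.lt_top hf.2)⟩

theorem tendsto_eLpNorm_two_of_discrete (hp0 : p ≠ 0) (hp2 : p ≤ 2) {u : ℕ → G → ℂ}
    (hu : Tendsto (fun n => eLpNorm (u n) p μ) atTop (𝓝 0)) :
    Tendsto (fun n => eLpNorm (u n) 2 μ) atTop (𝓝 0) := by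
  obtain ⟨D, hD, hDf⟩ := exists_eLpNorm_two_le (μ := μ) hp0 hp2
  have h : Tendsto (fun n => D * eLpNorm (u n) p μ) atTop (𝓝 0) := by
    simpa using ENNReal.Tendsto.const_mul hu (Or.inr hD)
  exact tendsto_of_tendsto_of_tendsto_of_le_of_le tendsto_const_nhds h (fun _ => zero_le)
    fun n => hDf _

variable [μ.IsInvInvariant]

/-- Since `L^p ⊆ L^2`, Cauchy–Schwarz makes the existence of the convolutions automatic. -/
theorem mem_carrier_iff_of_discrete (hp0 : p ≠ 0) (hp2 : p ≤ 2) {f : Lp ℂ p μ} :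
    f ∈ carrier μ p ↔ enormT μ p f < ∞ :=
  ⟨fun h => h.2, fun h => ⟨fun g => Eventually.of_forall fun x =>
    integrable_conv (a := 2) (b := 2) (memLp_two_of_discrete hp0 hp2 (Lp.memLp g))
      (memLp_two_of_discrete hp0 hp2 (Lp.memLp f)) x, h⟩⟩

/-- Associativity of convolution for finitely supported left factor. -/
theorem conv_conv_of_finset {u f g : G → ℂ} {T : Finset G} (hT : ∀ y ∉ T, u y = 0)
    (hf : MemLp f 2 μ) (hg : MemLp g 2 μ) (x : G) :
    conv μ (conv μ u f) g x = conv μ u (conv μ f g) x := by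
  rw [conv_eq_sum hT]
  have hint : ∀ w, Integrable (fun y => f (w⁻¹ * y) * g (y⁻¹ * x)) μ := fun w =>
    integrable_conv (a := 2) (b := 2)
      (hf.comp_measurePreserving (measurePreserving_mul_left μ w⁻¹)) hg x
  calc conv μ (conv μ u f) g x
      = ∫ y, ∑ w ∈ T, (μ.real {(1 : G)} * u w) * (f (w⁻¹ * y) * g (y⁻¹ * x)) ∂μ := by
        refine integral_congr_ae (Eventually.of_forall fun y => ?_)
        simp only [conv_eq_sum hT, Finset.sum_mul]
        refine Finset.sum_congr rfl fun w _ => ?_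
        rw [Complex.real_smul]
        ring
    _ = ∑ w ∈ T, (μ.real {(1 : G)} * u w) * ∫ y, f (w⁻¹ * y) * g (y⁻¹ * x) ∂μ := by
        rw [integral_finsetSum _ fun w _ => (hint w).const_mul _]
        simp_rw [integral_const_mul]
    _ = _ := by
        refine Finset.sum_congr rfl fun w _ => ?_
        rw [Complex.real_smul, mul_assoc, conv,
          ← integral_mul_left_eq_self (fun y => f (w⁻¹ * y) * g (y⁻¹ * x)) w]
        simp [mul_assoc]

/-- Approximate `h` in `L^p` by finitely supported `u n`, for which associativity is an interchange
with a finite sum. Both sides converge pointwise: the left because `h ↦ h * f` is bounded on `L^p`,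
the right because `f * g` lies in `L^p ⊆ L^2`. -/
theorem conv_assoc_of_discrete [μ.Regular] [Fact (1 ≤ p)] (hp2 : p ≤ 2) {h : G → ℂ}
    (hh : MemLp h p μ)
    {f g : Lp ℂ p μ} (hf : f ∈ carrier μ p) (hg : g ∈ carrier μ p) :
    conv μ (conv μ h f) g = conv μ h (conv μ f g) := by
  have hfgm : MemLp (conv μ f g) p μ := memLp_conv_of_discrete (Lp.memLp f) hg
  have hp1 : 1 ≤ p := Fact.out
  have hp0 : p ≠ 0 := (zero_lt_one.trans_le hp1).ne'
  have hp_top : p ≠ ∞ := (hp2.trans_lt ENNReal.ofNat_lt_top).ne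
  have two {k : G → ℂ} (hk : MemLp k p μ) : MemLp k 2 μ := memLp_two_of_discrete hp0 hp2 hk
  obtain ⟨u, -, hus, hu⟩ := exists_seq_hasCompactSupport_tendsto hp_top hh
  have hum : ∀ n, MemLp (u n) p μ := fun n =>
    continuous_of_discreteTopology.memLp_of_hasCompactSupport (hus n)
  funext x
  have hA : Tendsto (fun n => conv μ (conv μ (u n) f) g x) atTop
      (𝓝 (conv μ (conv μ h f) g x)) := by
    refine tendsto_conv_left (a := 2) (b := 2) (fun n => two (memLp_conv_of_discrete (hum n) hf))
      (two (memLp_conv_of_discrete hh hf)) (two (Lp.memLp g))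
      (tendsto_eLpNorm_two_of_discrete hp0 hp2 ?_) x
    have hlim : Tendsto (fun n => eLpNorm (u n - h) p μ * enormT μ p f) atTop (𝓝 0) := by
      simpa using ENNReal.Tendsto.mul_const hu (Or.inr hf.2.ne)
    refine tendsto_of_tendsto_of_tendsto_of_le_of_le tendsto_const_nhds hlim (fun _ => zero_le)
      fun n => ?_
    rw [← conv_sub_left (two (hum n)) (two hh) (two (Lp.memLp f))]
    exact eLpNorm_conv_le_mul_enormT ((hum n).sub hh) f
  have hB : Tendsto (fun n => conv μ (u n) (conv μ f g) x) atTop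
      (𝓝 (conv μ h (conv μ f g) x)) :=
    tendsto_conv_left (a := 2) (b := 2) (fun n => two (hum n)) (two hh) (two hfgm)
      (tendsto_eLpNorm_two_of_discrete hp0 hp2 hu) x
  refine tendsto_nhds_unique hA (hB.congr fun n => ?_)
  have hfin : (Function.support (u n)).Finite :=
    (isCompact_iff_finite.1 (hus n)).subset (subset_tsupport _)
  refine (conv_conv_of_finset (T := hfin.toFinset) (fun y hy => ?_) (two (Lp.memLp f))
    (two (Lp.memLp g)) x).symm
  simpa using hy

end Discrete

/-! ### Exact representatives on discrete spaces -/

section CoeFn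

variable {X : Type*} [TopologicalSpace X] [DiscreteTopology X] [MeasurableSpace X]
  {μ : Measure X} [μ.IsOpenPosMeasure] {p : ℝ≥0∞}

theorem coeFn_add_of_discrete (f g : Lp ℂ p μ) : ((f + g : Lp ℂ p μ) : X → ℂ) = f + g :=
  eq_of_ae_eq_of_discrete (Lp.coeFn_add f g)

theorem coeFn_smul_of_discrete (c : ℂ) (f : Lp ℂ p μ) :
    ((c • f : Lp ℂ p μ) : X → ℂ) = c • (f : X → ℂ) :=
  eq_of_ae_eq_of_discrete (Lp.coeFn_smul c f)

theorem enormT_smul_of_discrete [Group X] (c : ℂ) (f : Lp ℂ p μ) :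
    enormT μ p (c • f) = ‖c‖ₑ * enormT μ p f := by
  simp only [enormT, coeFn_smul_of_discrete, conv_const_smul_right, eLpNorm_const_smul,
    ENNReal.mul_iSup]

theorem enormT_zero_of_discrete [Group X] : enormT μ p (0 : Lp ℂ p μ) = 0 := by
  have h := enormT_smul_of_discrete (0 : ℂ) (0 : Lp ℂ p μ)
  simpa using h

end CoeFn

/-! ### The Banach algebra of a discrete group -/

section DiscreteAlgebra

variable {G : Type*} [Group G] [TopologicalSpace G] [MeasurableSpace G] [BorelSpace G]
  [DiscreteTopology G] [IsTopologicalGroup G] {μ : Measure G} [μ.IsHaarMeasure]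
  [μ.IsInvInvariant] {p : ℝ≥0∞}

theorem enormT_add_le_of_discrete (hp1 : 1 ≤ p) (hp2 : p ≤ 2) (f g : Lp ℂ p μ) :
    enormT μ p (f + g) ≤ enormT μ p f + enormT μ p g := by
  have hp0 : p ≠ 0 := (zero_lt_one.trans_le hp1).ne'
  refine iSup₂_le fun k hk => ?_
  have two (h : Lp ℂ p μ) : MemLp h 2 μ := memLp_two_of_discrete hp0 hp2 (Lp.memLp h)
  rw [coeFn_add_of_discrete, conv_add_right (a := 2) (b := 2) (two k) (two f) (two g)]
  refine (eLpNorm_add_le (aestronglyMeasurable_of_discrete _)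
    (aestronglyMeasurable_of_discrete _) hp1).trans (add_le_add ?_ ?_)
  · exact le_iSup₂ (f := fun (g : Lp ℂ p μ) (_ : ‖g‖ ≤ 1) => eLpNorm (conv μ g f) p μ) k hk
  · exact le_iSup₂ (f := fun (k : Lp ℂ p μ) (_ : ‖k‖ ≤ 1) => eLpNorm (conv μ k g) p μ) k hk

variable (μ) in
/-- The space `L_p^T` of a discrete group as a submodule of `L^p`. -/
noncomputable def submoduleOfDiscrete (hp1 : 1 ≤ p) (hp2 : p ≤ 2) : Submodule ℂ (Lp ℂ p μ) where
  carrier := carrier μ p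
  zero_mem' := by
    rw [mem_carrier_iff_of_discrete (zero_lt_one.trans_le hp1).ne' hp2, enormT_zero_of_discrete]
    exact ENNReal.zero_lt_top
  add_mem' {f g} hf hg := by
    rw [mem_carrier_iff_of_discrete (zero_lt_one.trans_le hp1).ne' hp2]
    exact (enormT_add_le_of_discrete hp1 hp2 f g).trans_lt (ENNReal.add_lt_top.2 ⟨hf.2, hg.2⟩)
  smul_mem' c f hf := by
    rw [mem_carrier_iff_of_discrete (zero_lt_one.trans_le hp1).ne' hp2, enormT_smul_of_discrete]
    exact ENNReal.mul_lt_top enorm_lt_top hf.2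

theorem mem_submoduleOfDiscrete {hp1 : 1 ≤ p} {hp2 : p ≤ 2} {f : Lp ℂ p μ} :
    f ∈ submoduleOfDiscrete μ hp1 hp2 ↔ f ∈ carrier μ p := Iff.rfl

/-- By associativity, convolving with `f * g` is the composition of the two operators, so the
operator norms multiply. -/
theorem enormT_toLp_conv_le_of_discrete [μ.Regular] [Fact (1 ≤ p)] (hp2 : p ≤ 2) {f g : Lp ℂ p μ}
    (hf : f ∈ carrier μ p) (hg : g ∈ carrier μ p) :
    enormT μ p ((memLp_conv_of_discrete (Lp.memLp f) hg).toLp _) ≤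
      enormT μ p f * enormT μ p g := by
  refine iSup₂_le fun k hk => ?_
  rw [conv_congr_right _ (MemLp.coeFn_toLp _), ← conv_assoc_of_discrete hp2 (Lp.memLp k) hf hg]
  refine (eLpNorm_conv_le_mul_enormT (memLp_conv_of_discrete (Lp.memLp k) hf) g).trans ?_
  gcongr
  exact le_iSup₂ (f := fun (k : Lp ℂ p μ) (_ : ‖k‖ ≤ 1) => eLpNorm (conv μ k f) p μ) k hk

/-- On a discrete group, `‖·‖_p^T` is lower semicontinuous along sequences converging in `L^p`. -/
theorem enormT_le_of_tendsto_of_discrete [Fact (1 ≤ p)] (hp2 : p ≤ 2) {u : ℕ → Lp ℂ p μ}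
    {a : Lp ℂ p μ} (hu : Tendsto u atTop (𝓝 a)) {C : ℝ≥0∞}
    (hC : ∀ᶠ n in atTop, enormT μ p (u n) ≤ C) : enormT μ p a ≤ C := by
  have hp1 : 1 ≤ p := Fact.out
  have hp0 : p ≠ 0 := (zero_lt_one.trans_le hp1).ne'
  have two (h : Lp ℂ p μ) : MemLp h 2 μ := memLp_two_of_discrete hp0 hp2 (Lp.memLp h)
  refine iSup₂_le fun k hk => ?_
  refine Lp.eLpNorm_le_of_ae_tendsto (u := atTop) (f := fun n => conv μ k (u n)) ?_
    (fun n => aestronglyMeasurable_of_discrete _) (Eventually.of_forall fun x => ?_)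
  · filter_upwards [hC] with n hn
    exact (le_iSup₂ (f := fun (k : Lp ℂ p μ) (_ : ‖k‖ ≤ 1) => eLpNorm (conv μ k (u n)) p μ)
      k hk).trans hn
  · exact tendsto_conv_right (a := 2) (b := 2) (two k) (fun n => two (u n)) (two a)
      (tendsto_eLpNorm_two_of_discrete hp0 hp2
        ((Lp.tendsto_Lp_iff_tendsto_eLpNorm' u a).1 hu)) x

/-- By (iv) the sequence is Cauchy in `L^p`; its limit there is also the limit in `‖·‖_p^T`, by
lower semicontinuity applied to `v n - v m` as `m → ∞`. -/
theorem exists_normT_lim_of_discrete [Fact (1 ≤ p)] (hp1 : 1 ≤ p) (hp2 : p ≤ 2)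
    (u : ℕ → submoduleOfDiscrete μ hp1 hp2)
    (hu : ∀ ε > 0, ∃ n₀, ∀ m ≥ n₀, ∀ n ≥ n₀,
      normT μ p ((u m - u n : submoduleOfDiscrete μ hp1 hp2) : Lp ℂ p μ) < ε) :
    ∃ a : submoduleOfDiscrete μ hp1 hp2, ∀ ε > 0, ∃ n₀, ∀ n ≥ n₀,
      normT μ p ((u n - a : submoduleOfDiscrete μ hp1 hp2) : Lp ℂ p μ) < ε := by
  obtain ⟨K, hK, hKf⟩ := norm_le_mul_normT_of_discrete (μ := μ) (p := p)
  let v : ℕ → Lp ℂ p μ := fun n => u n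
  have hcau : CauchySeq v := by
    rw [Metric.cauchySeq_iff]
    intro ε hε
    obtain ⟨n₀, h⟩ := hu (ε / K) (div_pos hε hK)
    refine ⟨n₀, fun m hm n hn => ?_⟩
    rw [dist_eq_norm]
    calc ‖v m - v n‖ ≤ K * normT μ p (v m - v n) := hKf _ (u m - u n).2
      _ < K * (ε / K) := mul_lt_mul_of_pos_left (h m hm n hn) hK
      _ = ε := mul_div_cancel₀ _ hK.ne'
  obtain ⟨a, ha⟩ := cauchySeq_tendsto_of_complete hcau
  have key : ∀ ε > 0, ∃ n₀, ∀ n ≥ n₀, enormT μ p (v n - a) ≤ ENNReal.ofReal ε := by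
    intro ε hε
    obtain ⟨n₀, h⟩ := hu ε hε
    refine ⟨n₀, fun n hn => ?_⟩
    refine enormT_le_of_tendsto_of_discrete hp2 (u := fun m => v n - v m) (ha.const_sub _) ?_
    filter_upwards [eventually_ge_atTop n₀] with m hm
    refine (enormT_eq_ofReal_normT (u n - u m).2).trans_le ?_
    exact ENNReal.ofReal_le_ofReal (h n hn m hm).le
  have hmem : a ∈ submoduleOfDiscrete μ hp1 hp2 := by
    obtain ⟨n₀, h⟩ := key 1 one_pos
    have h1 : v n₀ - a ∈ submoduleOfDiscrete μ hp1 hp2 :=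
      mem_submoduleOfDiscrete.2 ((mem_carrier_iff_of_discrete
        (zero_lt_one.trans_le hp1).ne' hp2).2 ((h n₀ le_rfl).trans_lt ENNReal.ofReal_lt_top))
    rw [← sub_sub_cancel (v n₀) a]
    exact sub_mem (u n₀).2 h1
  refine ⟨⟨a, hmem⟩, fun ε hε => ?_⟩
  -- Semicontinuity only yields `≤`; halving `ε` restores the strict inequality.
  obtain ⟨n₀, h⟩ := key (ε / 2) (half_pos hε)
  refine ⟨n₀, fun n hn => ?_⟩
  exact (ENNReal.toReal_le_of_le_ofReal (half_pos hε).le (h n hn)).trans_lt (half_lt_self hε)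

theorem isConvBanachAlgebra_of_discrete [μ.Regular] (hp1 : 1 ≤ p) (hp2 : p ≤ 2) :
    IsConvBanachAlgebra μ p := by
  have : Fact (1 ≤ p) := ⟨hp1⟩
  have hp0 : p ≠ 0 := (zero_lt_one.trans_le hp1).ne'
  have two (h : Lp ℂ p μ) : MemLp h 2 μ := memLp_two_of_discrete hp0 hp2 (Lp.memLp h)
  let S := submoduleOfDiscrete μ hp1 hp2
  have hle : ∀ f g : S, enormT μ p ((memLp_conv_of_discrete (Lp.memLp f.1) g.2).toLp _) ≤
      enormT μ p f.1 * enormT μ p g.1 := fun f g => enormT_toLp_conv_le_of_discrete hp2 f.2 g.2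
  let mul : S → S → S := fun f g => ⟨(memLp_conv_of_discrete (Lp.memLp f.1) g.2).toLp _,
    mem_submoduleOfDiscrete.2 ((mem_carrier_iff_of_discrete hp0 hp2).2
      ((hle f g).trans_lt (ENNReal.mul_lt_top f.2.2 g.2.2)))⟩
  have hmul : ∀ f g : S, (((mul f g : S) : Lp ℂ p μ) : G → ℂ)
      = conv μ (f : Lp ℂ p μ) (g : Lp ℂ p μ) := fun f g =>
    eq_of_ae_eq_of_discrete (memLp_conv_of_discrete (Lp.memLp f.1) g.2).coeFn_toLp
  have hext : ∀ f g : S, ((f : Lp ℂ p μ) : G → ℂ) = ((g : Lp ℂ p μ) : G → ℂ) → f = g :=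
    fun f g h => Subtype.ext (Lp.ext (EventuallyEq.of_eq h))
  have hadd : ∀ f g : S, (((f + g : S) : Lp ℂ p μ) : G → ℂ)
      = ((f : Lp ℂ p μ) : G → ℂ) + ((g : Lp ℂ p μ) : G → ℂ) := fun f g => coeFn_add_of_discrete _ _
  have hsmul : ∀ (z : ℂ) (f : S), (((z • f : S) : Lp ℂ p μ) : G → ℂ)
      = z • ((f : Lp ℂ p μ) : G → ℂ) := fun z f => coeFn_smul_of_discrete _ _
  refine ⟨S, rfl, mul, fun f g => EventuallyEq.of_eq (hmul f g), ?_⟩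
  constructor
  · intro a
    constructor
    · intro h
      -- Definiteness of `‖·‖_p^T` is a consequence of (iv).
      obtain ⟨K, -, hKf⟩ := norm_le_mul_normT_of_discrete (μ := μ) (p := p)
      have h1 := hKf a a.2
      rw [show normT μ p a = 0 from h, mul_zero] at h1
      exact Subtype.ext (norm_le_zero_iff.1 h1)
    · rintro rfl
      simp [normT, enormT_zero_of_discrete]
  · intro a b
    simp only [normT]
    rw [← ENNReal.toReal_add a.2.2.ne b.2.2.ne]
    exact ENNReal.toReal_mono (ENNReal.add_ne_top.2 ⟨a.2.2.ne, b.2.2.ne⟩)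
      (enormT_add_le_of_discrete hp1 hp2 _ _)
  · intro c a
    simp only [normT, Submodule.coe_smul]
    rw [enormT_smul_of_discrete, ENNReal.toReal_mul, toReal_enorm]
  · intro a b c
    refine hext _ _ ?_
    rw [hmul, hmul, hmul, hmul]
    exact conv_assoc_of_discrete hp2 (Lp.memLp _) b.2 c.2
  · intro a b c
    refine hext _ _ ?_
    rw [hadd, hmul, hmul, hmul, hadd]
    exact conv_add_left (a := 2) (b := 2) (two _) (two _) (two _)
  · intro a b c
    refine hext _ _ ?_
    rw [hadd, hmul, hmul, hmul, hadd]
    exact conv_add_right (a := 2) (b := 2) (two _) (two _) (two _)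
  · intro z a b
    refine hext _ _ ?_
    rw [hsmul, hmul, hmul, hsmul]
    exact conv_const_smul_left z _ _
  · intro z a b
    refine hext _ _ ?_
    rw [hsmul, hmul, hmul, hsmul]
    exact conv_const_smul_right z _ _
  · intro a b
    simp only [normT]
    rw [← ENNReal.toReal_mul]
    exact ENNReal.toReal_mono (ENNReal.mul_ne_top a.2.2.ne b.2.2.ne) (hle a b)
  · exact exists_normT_lim_of_discrete hp1 hp2

end DiscreteAlgebra

/-! ### Formal implications between the norm inequalities -/

theorem equivOn_of_norm_le {G : Type*} [Group G] [MeasurableSpace G] {μ : Measure G} {p : ℝ≥0∞}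
    (h : ∃ K > 0, ∀ f ∈ carrier μ p, ‖f‖ ≤ K * normT μ p f) :
    EquivOn (carrier μ p) (normT μ p) (sumNormT μ p) := by
  obtain ⟨K, hK, hKf⟩ := h
  refine ⟨1, one_pos, K + 1, by positivity, fun f hf => ⟨?_, ?_⟩⟩
  · rw [one_mul, sumNormT]
    exact le_add_of_nonneg_left ENNReal.toReal_nonneg
  · rw [sumNormT, add_mul, one_mul]
    exact add_le_add (hKf f hf) le_rfl

theorem sumNormT_le_of_equivOn {G : Type*} [Group G] [MeasurableSpace G] {μ : Measure G}
    {p : ℝ≥0∞} (h : EquivOn (carrier μ p) (normT μ p) (sumNormT μ p)) :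
    ∃ K > 0, ∀ f ∈ carrier μ p, sumNormT μ p f ≤ K * normT μ p f := by
  obtain ⟨_, _, C, hC, h⟩ := h
  exact ⟨C, hC, fun f hf => (h f hf).2⟩

theorem norm_le_of_sumNormT_le {G : Type*} [Group G] [MeasurableSpace G] {μ : Measure G}
    {p : ℝ≥0∞} (h : ∃ K > 0, ∀ f ∈ carrier μ p, sumNormT μ p f ≤ K * normT μ p f) :
    ∃ K > 0, ∀ f ∈ carrier μ p, ‖f‖ ≤ K * normT μ p f := by
  obtain ⟨K, hK, h⟩ := h
  exact ⟨K, hK, fun f hf => (le_add_of_nonneg_right ENNReal.toReal_nonneg).trans (h f hf)⟩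

end LpT

theorem theoremt2 {G : Type*} [Group G] [TopologicalSpace G] [IsTopologicalGroup G]
    [LocallyCompactSpace G] [T2Space G] [MeasurableSpace G] [BorelSpace G]
    (μ : Measure G) [μ.IsHaarMeasure] [μ.Regular]
    (p : ℝ≥0∞) (hp : 1 < p) (hp_top : p ≠ ∞) :
    (DiscreteTopology G →
      ∃ K > 0, ∀ f ∈ LpT.carrier μ p, ‖f‖ ≤ K * LpT.normT μ p f) ∧
    ((∃ K > 0, ∀ f ∈ LpT.carrier μ p, ‖f‖ ≤ K * LpT.normT μ p f) →
      LpT.EquivOn (LpT.carrier μ p) (LpT.normT μ p) (LpT.sumNormT μ p)) ∧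
    (LpT.EquivOn (LpT.carrier μ p) (LpT.normT μ p) (LpT.sumNormT μ p) →
      ∃ K > 0, ∀ f ∈ LpT.carrier μ p, LpT.sumNormT μ p f ≤ K * LpT.normT μ p f) ∧
    (μ.IsMulRightInvariant → p ≤ 2 →
      List.TFAE [
        LpT.IsConvBanachAlgebra μ p,
        ∃ K > 0, ∀ f ∈ LpT.carrier μ p, LpT.sumNormT μ p f ≤ K * LpT.normT μ p f,
        LpT.EquivOn (LpT.carrier μ p) (LpT.normT μ p) (LpT.sumNormT μ p),
        ∃ K > 0, ∀ f ∈ LpT.carrier μ p, ‖f‖ ≤ K * LpT.normT μ p f,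
        DiscreteTopology G]) := by
  have : Fact (1 ≤ p) := ⟨hp.le⟩
  refine ⟨fun _ => LpT.norm_le_mul_normT_of_discrete, LpT.equivOn_of_norm_le,
    LpT.sumNormT_le_of_equivOn, fun _ hp2 => ?_⟩
  have := LpT.isInvInvariant_of_isMulRightInvariant μ
  tfae_have 1 → 5 := LpT.discreteTopology_of_isConvBanachAlgebra hp hp_top
  tfae_have 5 → 1 := fun _ => LpT.isConvBanachAlgebra_of_discrete hp.le hp2
  tfae_have 5 → 4 := fun _ => LpT.norm_le_mul_normT_of_discrete
  tfae_have 4 → 3 := LpT.equivOn_of_norm_le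
  tfae_have 3 → 2 := LpT.sumNormT_le_of_equivOn
  tfae_have 2 → 4 := LpT.norm_le_of_sumNormT_le
  tfae_have 4 → 5 := LpT.discreteTopology_of_norm_le_normT hp hp_top
  tfae_finish
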